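/- **Setting.** Consider $N$ players with states $x_t\in\mathbb R^{n_x}$, inputs $u_t^i\in\mathbb R^{n_u}$, horizon $T$ and dynamics $x_{t+1}=A_tx_t+\sum_i B_t^iu_t^i+w_t$, $0\le t<T$, where $x_0\sim\mathcal N(\mu_0,\chi_0)$ with $\chi_0\succ0$ and $w_t\sim\mathcal N(0,\Sigma_t)$ with $\Sigma_t\succeq 0$ are independent. Let $u_t^i=-K_t^ix_t-\alpha_t^i$ be affine feedback policies (for instance the feedback Nash equilibrium of a linear-quadratic Gaussian game) for which $F_t=A_t-\sum_jB_t^jK_t^j$ is invertible for all $0\le t<T$. **Identification algorithm.** Fix $\tau>0$. Given policies $(K,\alpha)$, the parameters $\theta_t^i=[\operatorname{vec}(Q_t^i)^\top,(l_t^i)^\top,\operatorname{vec}(R_{t-1}^i)^\top,1]^\top$ are computed for $t=T,T-1,\dots,1$ as follows. Put $\Delta_T^i=0$, $\Omega_T^i=0$ and, for $t<T$, with $P_{t+1}^i=\Delta_{t+1}^i+Q_{t+1}^i$ and $\zeta_{t+1}^i=\Omega_{t+1}^i+l_{t+1}^i$, $$\Delta_t^i=F_t^\top P_{t+1}^iF_t+K_t^{i\top}R_t^iK_t^i,\qquad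 \Omega_t^i=F_t^\top\Big(\zeta_{t+1}^i-P_{t+1}^i\sum_jB_t^j\alpha_t^j\Big)+K_t^{i\top}R_t^i\alpha_t^i .$$ With $S_t^i=F_t^\top\otimes B_t^{i\top}$ and $E_t^i=K_t^iF_t^{-1}\sum_jB_t^j\alpha_t^j+\alpha_t^i$, let $$M_t^i=\begin{bmatrix}S_{t-1}^i&0&-K_{t-1}^{i\top}\otimes I&S_{t-1}^i\operatorname{vec}(\Delta_t^i)\\0&B_{t-1}^{i\top}&-E_{t-1}^{i\top}\otimes I&B_{t-1}^{i\top}\Omega_t^i\end{bmatrix},$$ and let $\theta_t^i$ be a minimizer of $\|M_t^i\theta\|_2^2$ over all $\theta$ whose last entry is $1$, whose $R$-part is diagonal, and which satisfy $D\theta\ge\tau$ entrywise, where $D$ selects all entries of $Q$ and $l$ and the diagonal entries of $R$. The active set of $\theta$ is $\mathcal A(\theta)=\{j:(D\theta)_j=\tau\}$. If several minimizers have the same active set, the one of least Euclidean norm among them is taken. **Estimation.** Let $n$ independent trajectories $(x_t^{(s)})_t$ be generated under $(K,\alpha)$, and let the inputs be observed as $u_t^{i(s)}=-K_t^ix_t^{(s)}-\alpha_t^i+\nu_t^{i(s)}$,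 where the noises $\nu_t^{i(s)}$ are centred, entrywise sub-Gaussian with a fixed variance proxy $\sigma^2$, independent of the initial states and the system noise, and independent across $s$. Let $[\widehat K_t^i,\widehat\alpha_t^i]$ minimize $\sum_{s=1}^n\|Kx_t^{(s)}+\alpha+u_t^{i(s)}\|_2^2$, and let $\widehat\theta_t^i$, $\widehat M_t^i$ be obtained by running the algorithm on $(\widehat K,\widehat\alpha)$. **Theorem.** Let $\theta_t^i$ be obtained by running the algorithm on $(K,\alpha)$. There are constants $c_1,c_2,C,\varepsilon_0>0$, depending only on the dynamics, $(K,\alpha)$, $T$, $\mu_0,\chi_0,\Sigma_t$, $\sigma^2$, $\tau$ and $\theta$, such that with $$n(\varepsilon,\delta)=\max\Big\{\tfrac{c_1}{\varepsilon^{2}}\log\tfrac{2(n_x+1)}{\delta},\;c_2\log\tfrac{2(n_x+1)}{\delta}\Big\}$$ the following holds for all $\varepsilon>0$, $\delta\in(0,1)$ and $n\ge n(\varepsilon,\delta)$. 1. For all $0\le t<T$ and all $i$, $\ \mathbb P\big(\|[\widehat K_t^i,\widehat\alpha_t^i]-[K_t^i,\alpha_t^i]\|\le\varepsilon\big)\ge1-\delta$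 (Frobenius norm). 2. If $\varepsilon\le\varepsilon_0$, then for all $1\le t\le T$ and all $i$, with probability at least $(1-\delta)^{T-t+1}$, $$\|\widehat\theta_t^i-\theta_t^i\|_2\le C\varepsilon$$ holds whenever, for all $1\le r\le T$ and all $j$, $\mathcal A(\widehat\theta_r^j)=\mathcal A(\theta_r^j)$ and the submatrices of $\widehat M_r^j$ and $M_r^j$ formed by the columns of the free entries (those selected by $D$ whose constraint is inactive) have the same rank. In particular, if these conditions hold almost surely, then $\mathbb P(\|\widehat\theta_t^i-\theta_t^i\|_2\le C\varepsilon)\ge(1-\delta)^{T-t+1}$. -/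

import Mathlib

open MeasureTheory ProbabilityTheory Matrix
open scoped Kronecker NNReal

noncomputable section

/-- Linear dynamics `x_{t+1} = A_t x_t + ∑ᵢ B_tⁱ u_tⁱ + w_t` with `N` players. -/
structure LinearDynamics (N nx nu : ℕ) where
  A : ℕ → Matrix (Fin nx) (Fin nx) ℝ
  B : ℕ → Fin N → Matrix (Fin nx) (Fin nu) ℝ

/-- A profile of affine state-feedback policies `u_tⁱ = - K_tⁱ x_t - α_tⁱ`. -/
structure AffinePolicy (N nx nu : ℕ) where
  K : ℕ → Fin N → Matrix (Fin nu) (Fin nx) ℝ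
  α : ℕ → Fin N → Fin nu → ℝ

/-- Entries of `θ = [vec Q, l, vec R, 1]`; a matrix entry in row `a` and column `b` has the index
`(b, a)`, as in `Matrix.vec`. -/
abbrev ParamIdx (nx nu : ℕ) : Type :=
  (Fin nx × Fin nx) ⊕ (Fin nx ⊕ ((Fin nu × Fin nu) ⊕ Unit))

/-- Rows of the selector matrix: the entries of `Q`, those of `l`, and the diagonal of `R`. -/
abbrev ConstrIdx (nx nu : ℕ) : Type := (Fin nx × Fin nx) ⊕ (Fin nx ⊕ Fin nu)

section Identification

variable {N nx nu : ℕ}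

def paramQ (θ : ParamIdx nx nu → ℝ) : Matrix (Fin nx) (Fin nx) ℝ :=
  Matrix.of fun a b => θ (Sum.inl (b, a))

def paramL (θ : ParamIdx nx nu → ℝ) : Fin nx → ℝ :=
  fun a => θ (Sum.inr (Sum.inl a))

def paramR (θ : ParamIdx nx nu → ℝ) : Matrix (Fin nu) (Fin nu) ℝ :=
  Matrix.of fun a b => θ (Sum.inr (Sum.inr (Sum.inl (b, a))))

/-- Closed-loop matrix `F_t = A_t - ∑ⱼ B_tʲ K_tʲ`. -/
def closedLoop (dyn : LinearDynamics N nx nu) (pol : AffinePolicy N nx nu) (t : ℕ) :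
    Matrix (Fin nx) (Fin nx) ℝ :=
  dyn.A t - ∑ j, dyn.B t j * pol.K t j

/-- `∑ⱼ B_tʲ α_tʲ`. -/
def drift (dyn : LinearDynamics N nx nu) (pol : AffinePolicy N nx nu) (t : ℕ) : Fin nx → ℝ :=
  ∑ j, dyn.B t j *ᵥ pol.α t j

/-- `S_tⁱ = F_tᵀ ⊗ (B_tⁱ)ᵀ`. -/
def matS (dyn : LinearDynamics N nx nu) (pol : AffinePolicy N nx nu) (t : ℕ) (i : Fin N) :
    Matrix (Fin nx × Fin nu) (Fin nx × Fin nx) ℝ :=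
  (closedLoop dyn pol t)ᵀ ⊗ₖ (dyn.B t i)ᵀ

/-- `E_tⁱ = K_tⁱ F_t⁻¹ ∑ⱼ B_tʲ α_tʲ + α_tⁱ`. -/
def vecE (dyn : LinearDynamics N nx nu) (pol : AffinePolicy N nx nu) (t : ℕ) (i : Fin N) :
    Fin nu → ℝ :=
  (pol.K t i * (closedLoop dyn pol t)⁻¹) *ᵥ drift dyn pol t + pol.α t i

/-- The matrix `Δ_{T-k}ⁱ`: `Δ_T = 0` and `Δ_t = F_tᵀ P_{t+1} F_t + K_tᵀ R_t K_t`, where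
`P_{t+1} = Δ_{t+1} + Q_{t+1}` and where `Q_{t+1}` and `R_t` are entries of `θ_{t+1}`. -/
def deltaBack (T : ℕ) (dyn : LinearDynamics N nx nu) (pol : AffinePolicy N nx nu)
    (θ : ℕ → Fin N → ParamIdx nx nu → ℝ) (i : Fin N) : ℕ → Matrix (Fin nx) (Fin nx) ℝ
  | 0 => 0
  | k + 1 =>
    let t := T - (k + 1)
    (closedLoop dyn pol t)ᵀ * (deltaBack T dyn pol θ i k + paramQ (θ (t + 1) i)) *
        closedLoop dyn pol t
      + (pol.K t i)ᵀ * paramR (θ (t + 1) i) * pol.K t i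

/-- The vector `Ω_{T-k}ⁱ`: `Ω_T = 0` and
`Ω_t = F_tᵀ (ζ_{t+1} - P_{t+1} ∑ⱼ B_tʲ α_tʲ) + K_tᵀ R_t α_t`, where `ζ_{t+1} = Ω_{t+1} + l_{t+1}`
and `P_{t+1} = Δ_{t+1} + Q_{t+1}`. -/
def omegaBack (T : ℕ) (dyn : LinearDynamics N nx nu) (pol : AffinePolicy N nx nu)
    (θ : ℕ → Fin N → ParamIdx nx nu → ℝ) (i : Fin N) : ℕ → Fin nx → ℝ
  | 0 => 0
  | k + 1 =>
    let t := T - (k + 1)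
    (closedLoop dyn pol t)ᵀ *ᵥ
        (omegaBack T dyn pol θ i k + paramL (θ (t + 1) i)
          - (deltaBack T dyn pol θ i k + paramQ (θ (t + 1) i)) *ᵥ drift dyn pol t)
      + ((pol.K t i)ᵀ * paramR (θ (t + 1) i)) *ᵥ pol.α t i

/-- The matrix `M_tⁱ` for `1 ≤ t ≤ T`. It depends on `θ` only through `θ_{t+1}, …, θ_T`. -/
def matM (T : ℕ) (dyn : LinearDynamics N nx nu) (pol : AffinePolicy N nx nu)
    (θ : ℕ → Fin N → ParamIdx nx nu → ℝ) (t : ℕ) (i : Fin N) :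
    Matrix ((Fin nx × Fin nu) ⊕ Fin nu) (ParamIdx nx nu) ℝ :=
  Matrix.fromRows
    (Matrix.fromCols (matS dyn pol (t - 1) i)
      (Matrix.fromCols 0
        (Matrix.fromCols (-((pol.K (t - 1) i)ᵀ ⊗ₖ (1 : Matrix (Fin nu) (Fin nu) ℝ)))
          (Matrix.replicateCol Unit
            (matS dyn pol (t - 1) i *ᵥ (deltaBack T dyn pol θ i (T - t)).vec)))))
    (Matrix.fromCols 0
      (Matrix.fromCols (dyn.B (t - 1) i)ᵀ
        (Matrix.fromCols
          (-Matrix.of fun k q => vecE dyn pol (t - 1) i q.1 * (1 : Matrix (Fin nu) (Fin nu) ℝ) k q.2)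
          (Matrix.replicateCol Unit
            ((dyn.B (t - 1) i)ᵀ *ᵥ omegaBack T dyn pol θ i (T - t))))))

/-- The entry of `θ` selected by a row of the selector matrix. -/
def selected : ConstrIdx nx nu → ParamIdx nx nu
  | Sum.inl q => Sum.inl q
  | Sum.inr (Sum.inl a) => Sum.inr (Sum.inl a)
  | Sum.inr (Sum.inr a) => Sum.inr (Sum.inr (Sum.inl (a, a)))

/-- The selector matrix `D`. -/
def selectorD (nx nu : ℕ) : Matrix (ConstrIdx nx nu) (ParamIdx nx nu) ℝ :=
  Matrix.of fun j p => if selected j = p then 1 else 0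

/-- Feasible points of the least-squares problem: `D θ ≥ τ` entrywise, and the known entries of `θ`
have their values, that is, `R` has zero off-diagonal entries and the last entry is `1`. -/
def IsFeasible (τ : ℝ) (θ : ParamIdx nx nu → ℝ) : Prop :=
  (∀ j, τ ≤ (selectorD nx nu *ᵥ θ) j) ∧
  (∀ a b, a ≠ b → paramR θ a b = 0) ∧
  θ (Sum.inr (Sum.inr (Sum.inr ()))) = 1

/-- `θ` solves `min ‖M θ‖²` subject to feasibility. -/
def IsLSSolution (τ : ℝ) (M : Matrix ((Fin nx × Fin nu) ⊕ Fin nu) (ParamIdx nx nu) ℝ)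
    (θ : ParamIdx nx nu → ℝ) : Prop :=
  IsFeasible τ θ ∧ ∀ θ', IsFeasible τ θ' →
    ‖WithLp.toLp 2 (M *ᵥ θ)‖ ^ 2 ≤ ‖WithLp.toLp 2 (M *ᵥ θ')‖ ^ 2

/-- Indices of the constraints `D θ ≥ τ` that hold with equality. -/
def activeSet (τ : ℝ) (θ : ParamIdx nx nu → ℝ) : Set (ConstrIdx nx nu) :=
  {j | (selectorD nx nu *ᵥ θ) j = τ}

/-- Convention for rank-deficient problems: among the solutions with a given active set (there may
be a continuum of them), the one of least Euclidean norm is returned. The least-norm solution of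
the whole problem has this property, and so has every solution that is the only one with its
active set. -/
def IsReturnedSolution (τ : ℝ) (M : Matrix ((Fin nx × Fin nu) ⊕ Fin nu) (ParamIdx nx nu) ℝ)
    (θ : ParamIdx nx nu → ℝ) : Prop :=
  IsLSSolution τ M θ ∧ ∀ θ', IsLSSolution τ M θ' → activeSet τ θ' = activeSet τ θ →
    ‖WithLp.toLp 2 θ‖ ≤ ‖WithLp.toLp 2 θ'‖

/-- `θ_tⁱ`, `1 ≤ t ≤ T`, are the parameters found by the backward algorithm for the policy `pol`. -/
def IsIdentified (T : ℕ) (τ : ℝ) (dyn : LinearDynamics N nx nu) (pol : AffinePolicy N nx nu)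
    (θ : ℕ → Fin N → ParamIdx nx nu → ℝ) : Prop :=
  ∀ t, 1 ≤ t → t ≤ T → ∀ i, IsReturnedSolution τ (matM T dyn pol θ t i) (θ t i)

open Classical in
/-- Rank of the submatrix of `M` formed by the columns of the entries of `θ` that are free, that is,
selected by `D` with an inactive constraint. (The other columns of `M * Dᵀ` are set to zero.) -/
def freeRank (τ : ℝ) (M : Matrix ((Fin nx × Fin nu) ⊕ Fin nu) (ParamIdx nx nu) ℝ)
    (θ : ParamIdx nx nu → ℝ) : ℕ :=
  (M * (selectorD nx nu)ᵀ *
    Matrix.diagonal fun j => if j ∈ activeSet τ θ then (0 : ℝ) else 1).rank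

open scoped Matrix.Norms.Frobenius in
/-- Frobenius norm `‖[K̂_tⁱ, α̂_tⁱ] - [K_tⁱ, α_tⁱ]‖`. -/
def policyError (pol' pol : AffinePolicy N nx nu) (t : ℕ) (i : Fin N) : ℝ :=
  ‖Matrix.fromCols (pol'.K t i) (Matrix.replicateCol Unit (pol'.α t i))
    - Matrix.fromCols (pol.K t i) (Matrix.replicateCol Unit (pol.α t i))‖

end Identification

section Trajectories

variable {N nx nu : ℕ}

/-- The state `x_t` when all players apply `pol`, started at `x₀` and driven by the noise `w`. -/
def stateTraj (dyn : LinearDynamics N nx nu) (pol : AffinePolicy N nx nu)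
    (x₀ : Fin nx → ℝ) (w : ℕ → Fin nx → ℝ) : ℕ → Fin nx → ℝ
  | 0 => x₀
  | t + 1 =>
    dyn.A t *ᵥ stateTraj dyn pol x₀ w t
      + ∑ i, dyn.B t i *ᵥ (-(pol.K t i *ᵥ stateTraj dyn pol x₀ w t) - pol.α t i)
      + w t

/-- `(K, α)` minimizes `∑ₛ ‖K x⁽ˢ⁾ + α + u⁽ˢ⁾‖²`. -/
def IsRegression {n : ℕ} (x : Fin n → Fin nx → ℝ) (u : Fin n → Fin nu → ℝ)
    (K : Matrix (Fin nu) (Fin nx) ℝ) (α : Fin nu → ℝ) : Prop :=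
  ∀ (K' : Matrix (Fin nu) (Fin nx) ℝ) (α' : Fin nu → ℝ),
    ∑ s, ‖WithLp.toLp 2 (K *ᵥ x s + α + u s)‖ ^ 2
      ≤ ∑ s, ‖WithLp.toLp 2 (K' *ᵥ x s + α' + u s)‖ ^ 2

/-- `n` independent demonstrations over the horizon `T`: in each of them the initial state and the
system noises are independent Gaussians, and the input observation noises `ν_tⁱ` are centred
sub-Gaussian (entrywise, with variance proxy `σ2`; this implies mean zero) and independent of the
initial state and the system noise. The observation noises of one demonstration may depend on each
other in any way. -/
structure DemonstrationNoise {Ω : Type*} [MeasurableSpace Ω] (P : Measure Ω) (T n : ℕ)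
    (μ₀ : EuclideanSpace ℝ (Fin nx)) (χ₀ : Matrix (Fin nx) (Fin nx) ℝ)
    (Sig : ℕ → Matrix (Fin nx) (Fin nx) ℝ) (σ2 : ℝ≥0)
    (x₀ : Fin n → Ω → EuclideanSpace ℝ (Fin nx))
    (w : Fin n → ℕ → Ω → EuclideanSpace ℝ (Fin nx))
    (ν : Fin n → ℕ → Fin N → Ω → Fin nu → ℝ) : Prop where
  law_init : ∀ s, HasLaw (x₀ s) (multivariateGaussian μ₀ χ₀) P
  law_noise : ∀ s, ∀ t < T, HasLaw (w s t) (multivariateGaussian 0 (Sig t)) P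
  measurable_obs : ∀ s, ∀ t < T, ∀ i, Measurable (ν s t i)
  subgaussian_obs : ∀ s, ∀ t < T, ∀ i k, HasSubgaussianMGF (fun ω => ν s t i ω k) σ2 P
  indep_samples : iIndepFun (fun s ω =>
    (x₀ s ω, (fun t : Fin T => w s t ω), (fun (t : Fin T) (i : Fin N) => ν s t i ω))) P
  indep_noise : ∀ s, iIndepFun (fun (t : Fin T) ω => w s t ω) P
  indep_init : ∀ s, IndepFun (x₀ s) (fun ω (t : Fin T) => w s t ω) P
  indep_obs : ∀ s, IndepFun (fun ω (t : Fin T) (i : Fin N) => ν s t i ω)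
    (fun ω => (x₀ s ω, fun t : Fin T => w s t ω)) P

/-- The state `x_t⁽ˢ⁾` of a demonstration. -/
def demoState {Ω : Type*} {n : ℕ} (dyn : LinearDynamics N nx nu) (pol : AffinePolicy N nx nu)
    (x₀ : Fin n → Ω → EuclideanSpace ℝ (Fin nx))
    (w : Fin n → ℕ → Ω → EuclideanSpace ℝ (Fin nx)) (ω : Ω) (t : ℕ) (s : Fin n) : Fin nx → ℝ :=
  stateTraj dyn pol (x₀ s ω).ofLp (fun r => (w s r ω).ofLp) t

/-- The observed input `u_tⁱ⁽ˢ⁾ = - K_tⁱ x_t⁽ˢ⁾ - α_tⁱ + ν_tⁱ⁽ˢ⁾`. -/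
def demoInput {Ω : Type*} {n : ℕ} (dyn : LinearDynamics N nx nu) (pol : AffinePolicy N nx nu)
    (x₀ : Fin n → Ω → EuclideanSpace ℝ (Fin nx))
    (w : Fin n → ℕ → Ω → EuclideanSpace ℝ (Fin nx))
    (ν : Fin n → ℕ → Fin N → Ω → Fin nu → ℝ) (ω : Ω) (t : ℕ) (i : Fin N) (s : Fin n) :
    Fin nu → ℝ :=
  -(pol.K t i *ᵥ demoState dyn pol x₀ w ω t s) - pol.α t i + ν s t i ω

/-- `good` holds with probability at least `p`: it holds on a measurable event of at least this
probability. -/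
def HoldsWithProb {Ω : Type*} [MeasurableSpace Ω] (P : Measure Ω) (p : ℝ) (good : Ω → Prop) :
    Prop :=
  ∃ E : Set Ω, MeasurableSet E ∧ p ≤ P.real E ∧ ∀ ω ∈ E, good ω

/-- Sample size `n(ε, δ) = max {c₁ ε⁻² log (2 p / δ), c₂ log (2 p / δ)}` for a regression with `p`
regressors. -/
def sampleSize (c₁ c₂ : ℝ) (p : ℕ) (ε δ : ℝ) : ℝ :=
  max (c₁ / ε ^ 2 * Real.log (2 * p / δ)) (c₂ * Real.log (2 * p / δ))

end Trajectories

end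

/-! ### Perturbation of least-norm least-squares solutions at constant rank. -/

section ConstantRank

open scoped InnerProductSpace

variable {E F : Type*} [NormedAddCommGroup E] [InnerProductSpace ℝ E] [NormedAddCommGroup F]
  [InnerProductSpace ℝ F]

/-! The proof separates a deterministic stability estimate for the backward algorithm from a
concentration bound for the regression, and joins the two on a single event.

Stability. Small moves of the free entries keep feasibility and the active set, so a minimizer
satisfies the normal equations in its free entries; the least-norm convention makes these entries
orthogonal to the kernel of the free columns. The other entries are determined by the active set:
each is τ, 0 or 1. Hence, as long as the active set is the same, the true and the estimated free
entries are least-norm solutions of two unconstrained problems of minimizing ‖Gφ + b‖ with nearby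
data. Such solutions may jump when the rank of G changes. At constant rank the lower bound of G on
the orthogonal complement of its kernel persists, and the solution is locally Lipschitz
(`exists_leastNorm_leastSquares_lipschitz`, `IsReturnedSolution.exists_lipschitz`). The matrix M_t
arises from the policies and the later parameters by sums, products and the inverse of F_{t-1}, so
induction backward from T carries a policy error O(ε) to every θ_t (`identified_deviation`,
`exists_identified_lipschitz`).

Concentration. The regression error is bounded by the correlation of noise and regressors divided by
a lower bound for the empirical Gram matrix (`IsRegression.policyError_le`). The regressor z = [x,
1] is an affine function of Gaussian data, so exp(b z_q²) is integrable for small b > 0, and a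
Chernoff bound controls the correlation. The Gram matrix only has to be bounded below, so z zᵀ may
be replaced by z zᵀ / ‖z‖², whose entries are bounded and obey Hoeffding's inequality. The mean of
the latter is positive definite: for fixed system noise, the state is an invertible affine image of
the nondegenerate initial state.

A union bound over all times and players yields one event of probability at least 1 - δ on which
every policy error is at most ε. Both claims hold there, and (1 - δ)^(T - t + 1) ≤ 1 - δ. -/

theorem inner_eq_zero_of_eventually_norm_le {x y : E}
    (h : ∀ᶠ s : ℝ in nhds 0, ‖x‖ ≤ ‖x + s • y‖) : ⟪x, y⟫_ℝ = 0 := by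
  have hd : HasDerivAt (fun s : ℝ => ‖x + s • y‖ ^ 2) (2 * ⟪x, y⟫_ℝ) 0 := by
    have h1 : HasDerivAt (fun s : ℝ => x + s • y) y 0 := by
      simpa using ((hasDerivAt_id (0 : ℝ)).smul_const y).const_add x
    simpa using h1.norm_sq
  have hmin : IsLocalMin (fun s : ℝ => ‖x + s • y‖ ^ 2) 0 := by
    filter_upwards [h] with s hs
    simp only [zero_smul, add_zero]
    gcongr
  have := hmin.hasDerivAt_eq_zero hd
  linarith

variable [FiniteDimensional ℝ E]

/-- On (ker G)ᗮ the map is injective, and an injective linear map on a finite-dimensional space is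
bounded below. The constant plays the role of the smallest nonzero singular value. -/
theorem ContinuousLinearMap.exists_norm_ge_on_ker_orthogonal (G : E →L[ℝ] F) :
    ∃ c > 0, ∀ v ∈ (G.ker)ᗮ, c * ‖v‖ ≤ ‖G v‖ := by
  set L : (G.ker)ᗮ →ₗ[ℝ] F := (G : E →ₗ[ℝ] F).domRestrict _ with hL
  have hker : LinearMap.ker L = ⊥ := by
    rw [LinearMap.ker_eq_bot']
    intro v hv
    have h1 : (v : E) ∈ G.ker := hv
    have h2 := v.2 _ h1
    exact Subtype.ext (inner_self_eq_zero.1 h2)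
  obtain ⟨K, hK, hKL⟩ := L.exists_antilipschitzWith hker
  refine ⟨(K : ℝ)⁻¹, by positivity, fun v hv => ?_⟩
  have := hKL.le_mul_dist ⟨v, hv⟩ 0
  rw [dist_zero_right, map_zero, dist_zero_right] at this
  rw [inv_mul_le_iff₀ (by positivity)]
  exact this

/-- On the orthogonal complement of the kernel, the lower bound for a linear map persists for
nearby maps of the same rank. -/
theorem ContinuousLinearMap.norm_ge_on_ker_orthogonal_of_finrank_eq {G G' : E →L[ℝ] F} {c ε : ℝ}
    (hG : ∀ v ∈ (G.ker)ᗮ, c * ‖v‖ ≤ ‖G v‖) (hε : ‖G' - G‖ ≤ ε)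
    (hεc : ε < c)
    (hrank : Module.finrank ℝ G'.range = Module.finrank ℝ G.range) :
    ∀ v ∈ (G'.ker)ᗮ, (c - ε) * ‖v‖ ≤ ‖G' v‖ := by
  set W := (G.ker)ᗮ with hW
  have hlow : ∀ w ∈ W, (c - ε) * ‖w‖ ≤ ‖G' w‖ := by
    intro w hw
    have h1 := hG w hw
    have h2 : ‖(G' - G) w‖ ≤ ε * ‖w‖ := (G' - G).le_of_opNorm_le hε w
    have h3 : G w = G' w - (G' - G) w := by simp
    have h4 : ‖G w‖ ≤ ‖G' w‖ + ‖(G' - G) w‖ := by rw [h3]; exact norm_sub_le _ _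
    linarith
  set L : W →ₗ[ℝ] F := (G' : E →ₗ[ℝ] F).domRestrict W with hL
  have hinj : Function.Injective L := by
    rw [← LinearMap.ker_eq_bot, LinearMap.ker_eq_bot']
    intro w hw
    have h1 := hlow w w.2
    have h2 : G' w = 0 := hw
    rw [h2, norm_zero] at h1
    have h3 : ‖(w : E)‖ ≤ 0 := by
      by_contra hcon
      push Not at hcon
      nlinarith
    exact Subtype.ext (norm_le_zero_iff.1 h3)
  have hle : LinearMap.range L ≤ LinearMap.range (G' : E →ₗ[ℝ] F) := by
    rintro _ ⟨w, rfl⟩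
    exact ⟨w, rfl⟩
  -- G' is injective on W, and dim W = rank G = rank G'. Hence W is already mapped onto the whole
  -- range of G'.
  have hdim : Module.finrank ℝ (LinearMap.range L)
      = Module.finrank ℝ (LinearMap.range (G' : E →ₗ[ℝ] F)) := by
    rw [LinearMap.finrank_range_of_inj hinj]
    have h1 := (G : E →ₗ[ℝ] F).finrank_range_add_finrank_ker
    have h2 := (G.ker).finrank_add_finrank_orthogonal
    have h3 : Module.finrank ℝ (LinearMap.range (G' : E →ₗ[ℝ] F))
      = Module.finrank ℝ (LinearMap.range (G : E →ₗ[ℝ] F)) := hrank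
    rw [h3]
    change _ + Module.finrank ℝ W = _ at h2
    change _ + Module.finrank ℝ G.ker = _ at h1
    omega
  have heq := Submodule.eq_of_le_of_finrank_eq hle hdim
  intro v hv
  have hmem : G' v ∈ LinearMap.range L := by rw [heq]; exact ⟨v, rfl⟩
  obtain ⟨w, hw⟩ := hmem
  have hw' : G' w = G' v := hw
  have hk : v - w ∈ G'.ker := by
    change G' (v - w) = 0
    rw [map_sub, hw', sub_self]
  have h1 : ⟪v - w, v⟫_ℝ = 0 := hv _ hk
  -- Being orthogonal to ker G', v is the shortest preimage of G' v, so the lower bound at w passes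
  -- to v.
  have h2 : ‖v‖ ≤ ‖(w : E)‖ := by
    rw [inner_sub_left, real_inner_self_eq_norm_sq] at h1
    have h3 := real_inner_le_norm (w : E) v
    by_contra hcon
    push Not at hcon
    nlinarith [norm_nonneg (w : E)]
  calc (c - ε) * ‖v‖ ≤ (c - ε) * ‖(w : E)‖ := by
        have : 0 ≤ c - ε := by linarith
        gcongr
    _ ≤ ‖G' w‖ := hlow w w.2
    _ = ‖G' v‖ := by rw [hw']

/-- The least-norm solution of a linear least-squares problem is locally Lipschitz in the data
along perturbations that preserve the rank. -/
theorem exists_leastNorm_leastSquares_lipschitz (G : E →L[ℝ] F) (φ : E) (b : F)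
    (hker : ∀ v, G v = 0 → ⟪φ, v⟫_ℝ = 0) (hnormal : ∀ v, ⟪G φ + b, G v⟫_ℝ = 0) :
    ∃ C > 0, ∃ η > 0, ∀ (G' : E →L[ℝ] F) (φ' : E) (b' : F) (ε : ℝ), ε ≤ η →
      ‖G' - G‖ ≤ ε → ‖b' - b‖ ≤ ε →
      Module.finrank ℝ G'.range = Module.finrank ℝ G.range →
      (∀ v, G' v = 0 → ⟪φ', v⟫_ℝ = 0) → (∀ v, ⟪G' φ' + b', G' v⟫_ℝ = 0) →
      ‖φ' - φ‖ ≤ C * ε := by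
  obtain ⟨c, hc, hG⟩ := G.exists_norm_ge_on_ker_orthogonal
  set ρ := ‖G φ + b‖ with hρ
  set K := 1 + ‖φ‖ + 2 / c * ρ with hK
  have hK0 : 0 < K := by positivity
  -- The radius c / 2 keeps the lower bound c - ε of G' above c / 2. The two terms of the constant
  -- bound the parts of φ' - φ in (ker G')ᗮ and in ker G'.
  refine ⟨2 / c * K + ‖φ‖ / c, by positivity, c / 2, by positivity, ?_⟩
  intro G' φ' b' ε hεη hε hb hrank hker' hnormal'
  have hε0 : 0 ≤ ε := (norm_nonneg _).trans hε
  have hlow := ContinuousLinearMap.norm_ge_on_ker_orthogonal_of_finrank_eq hG hε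
    (by linarith) hrank
  set k : E := (G'.ker).starProjection φ with hk
  have hkmem : G' k = 0 := (G'.ker).starProjection_apply_mem φ
  have hφk : φ - k ∈ (G'.ker)ᗮ := (G'.ker).sub_starProjection_mem_orthogonal φ
  -- The component k of φ in ker G' is small: k is within ε‖k‖/c of ker G, because G k = -(G' - G)
  -- k, and φ is orthogonal to ker G.
  have hkk : ‖k‖ * ‖k‖ ≤ ‖φ‖ / c * ε * ‖k‖ := by
    have h1 : ⟪k, φ - k⟫_ℝ = 0 := hφk k hkmem
    rw [inner_sub_right, real_inner_self_eq_norm_mul_norm] at h1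
    set q : E := (G.ker).starProjection k
    have hq : G q = 0 := (G.ker).starProjection_apply_mem k
    have hkq : k - q ∈ (G.ker)ᗮ := (G.ker).sub_starProjection_mem_orthogonal k
    have h2 := hker q hq
    have h3 : ⟪φ, k⟫_ℝ = ⟪φ, k - q⟫_ℝ := by rw [inner_sub_right, h2, sub_zero]
    have h4 := real_inner_le_norm φ (k - q)
    have h5 := hG _ hkq
    have h6 : G (k - q) = -((G' - G) k) := by simp [hq, hkmem]
    rw [h6, norm_neg] at h5
    have h7 : ‖(G' - G) k‖ ≤ ε * ‖k‖ := (G' - G).le_of_opNorm_le hε k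
    have h8 : ‖k - q‖ ≤ ε * ‖k‖ / c := by
      rw [le_div_iff₀ hc]; linarith
    rw [real_inner_comm] at h1
    calc ‖k‖ * ‖k‖ = ⟪φ, k - q⟫_ℝ := by linarith
      _ ≤ ‖φ‖ * ‖k - q‖ := h4
      _ ≤ ‖φ‖ * (ε * ‖k‖ / c) := by gcongr
      _ = _ := by ring
  have hkb : ‖k‖ ≤ ‖φ‖ / c * ε := by
    rcases eq_or_lt_of_le (norm_nonneg k) with h | h
    · rw [← h]; positivity
    · exact le_of_mul_le_mul_right hkk h
  set d : E := φ' - (φ - k) with hd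
  have hdmem : d ∈ (G'.ker)ᗮ := by
    refine Submodule.sub_mem _ ?_ hφk
    intro v hv
    rw [real_inner_comm]
    exact hker' v hv
  have hdlow : ‖d‖ ≤ 2 / c * ‖G' d‖ := by
    have h1 := hlow d hdmem
    have h2 : c / 2 * ‖d‖ ≤ ‖G' d‖ := by
      refine le_trans ?_ h1
      have : c / 2 ≤ c - ε := by linarith
      gcongr
    rw [div_mul_eq_mul_div, le_div_iff₀ hc]
    linarith
  have hGd : ‖G' d‖ * ‖G' d‖ ≤ K * ε * ‖G' d‖ := by
    -- In the inner product with G' d the new residual drops out by the new normal equations. The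
    -- old residual need not be small, but it is orthogonal to G d and therefore meets only (G' - G)
    -- d.
    have h1 : G' d = (G' φ' + b') - (b' - b) - (G' - G) φ - (G φ + b) := by
      simp only [hd, map_sub, hkmem, FunLike.coe_sub, Pi.sub_apply]
      abel
    have h2 : ⟪G φ + b, G' d⟫_ℝ = ⟪G φ + b, (G' - G) d⟫_ℝ := by
      simp [inner_sub_right, hnormal d]
    have h3 : ‖G' d‖ * ‖G' d‖ = - ⟪b' - b, G' d⟫_ℝ - ⟪(G' - G) φ, G' d⟫_ℝ
        - ⟪G φ + b, (G' - G) d⟫_ℝ := by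
      rw [← real_inner_self_eq_norm_mul_norm]
      nth_rewrite 1 [h1]
      rw [inner_sub_left, inner_sub_left, inner_sub_left, hnormal' d, h2]
      ring
    have a1 := neg_le_of_abs_le (abs_real_inner_le_norm (b' - b) (G' d))
    have a2 := neg_le_of_abs_le (abs_real_inner_le_norm ((G' - G) φ) (G' d))
    have a3 := neg_le_of_abs_le (abs_real_inner_le_norm (G φ + b) ((G' - G) d))
    have b1 : ‖b' - b‖ * ‖G' d‖ ≤ ε * ‖G' d‖ := by gcongr
    have b2 : ‖(G' - G) φ‖ * ‖G' d‖ ≤ ε * ‖φ‖ * ‖G' d‖ := by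
      gcongr
      exact (G' - G).le_of_opNorm_le hε φ
    have b3 : ‖G φ + b‖ * ‖(G' - G) d‖ ≤ ρ * (ε * (2 / c * ‖G' d‖)) := by
      gcongr
      refine ((G' - G).le_of_opNorm_le hε d).trans ?_
      gcongr
    have : K * ε * ‖G' d‖ = ε * ‖G' d‖ + ε * ‖φ‖ * ‖G' d‖ + ρ * (ε * (2 / c * ‖G' d‖)) := by
      rw [hK]; ring
    linarith
  have hGdb : ‖G' d‖ ≤ K * ε := by
    rcases eq_or_lt_of_le (norm_nonneg (G' d)) with h | h
    · rw [← h]; positivity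
    · exact le_of_mul_le_mul_right hGd h
  calc ‖φ' - φ‖ = ‖d - k‖ := by rw [hd]; congr 1; abel
    _ ≤ ‖d‖ + ‖k‖ := norm_sub_le _ _
    _ ≤ 2 / c * (K * ε) + ‖φ‖ / c * ε := by
        gcongr
        exact hdlow.trans (by gcongr)
    _ = _ := by ring

end ConstantRank

/-! ### Reduction of the constrained problem to its free entries. -/

section LeastSquares

open scoped InnerProductSpace

variable {nx nu : ℕ}

theorem selected_injective : Function.Injective (selected : ConstrIdx nx nu → ParamIdx nx nu) := by
  rintro (a | a | a) (b | b | b) h <;> simp_all [selected]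

theorem selectorD_mulVec (θ : ParamIdx nx nu → ℝ) (j : ConstrIdx nx nu) :
    (selectorD nx nu *ᵥ θ) j = θ (selected j) := by
  simp [selectorD, Matrix.mulVec, dotProduct]

theorem selectorD_transpose_mulVec_selected (u : ConstrIdx nx nu → ℝ) (j : ConstrIdx nx nu) :
    ((selectorD nx nu)ᵀ *ᵥ u) (selected j) = u j := by
  simp [selectorD, Matrix.mulVec, dotProduct, selected_injective.eq_iff]

theorem selectorD_transpose_mulVec_of_notMem (u : ConstrIdx nx nu → ℝ) {p : ParamIdx nx nu}
    (hp : ∀ j : ConstrIdx nx nu, selected j ≠ p) : ((selectorD nx nu)ᵀ *ᵥ u) p = 0 := by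
  simp [selectorD, Matrix.mulVec, dotProduct, hp]

theorem selected_ne_offDiag {a b : Fin nu} (hab : a ≠ b) (j : ConstrIdx nx nu) :
    selected j ≠ Sum.inr (Sum.inr (Sum.inl (b, a))) := by
  rcases j with j | j | j <;> simp [selected]
  grind

theorem selected_ne_last (j : ConstrIdx nx nu) :
    selected j ≠ Sum.inr (Sum.inr (Sum.inr ())) := by
  rcases j with j | j | j <;> simp [selected]

/-- Every index is selected, an off-diagonal entry of `R`, or the last one. -/
theorem paramIdx_cases (p : ParamIdx nx nu) :
    (∃ j : ConstrIdx nx nu, selected j = p) ∨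
      (∃ a b : Fin nu, a ≠ b ∧ p = Sum.inr (Sum.inr (Sum.inl (b, a)))) ∨
      p = Sum.inr (Sum.inr (Sum.inr ())) := by
  rcases p with q | l | ⟨b, a⟩ | ⟨⟩
  · exact Or.inl ⟨Sum.inl q, rfl⟩
  · exact Or.inl ⟨Sum.inr (Sum.inl l), rfl⟩
  · by_cases h : a = b
    · subst h; exact Or.inl ⟨Sum.inr (Sum.inr a), rfl⟩
    · exact Or.inr (Or.inl ⟨a, b, h, rfl⟩)
  · exact Or.inr (Or.inr rfl)

open Classical in
/-- Diagonal projection onto the free entries. -/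
noncomputable def freeDiag (τ : ℝ) (θ : ParamIdx nx nu → ℝ) :
    Matrix (ConstrIdx nx nu) (ConstrIdx nx nu) ℝ :=
  Matrix.diagonal fun j => if j ∈ activeSet τ θ then (0 : ℝ) else 1

/-- The free entries of `θ`, extended by zero. -/
noncomputable def freePart (τ : ℝ) (θ : ParamIdx nx nu → ℝ) : ConstrIdx nx nu → ℝ :=
  freeDiag τ θ *ᵥ (selectorD nx nu *ᵥ θ)

/-- The entries of `θ` that are not free, extended by zero. -/
noncomputable def fixedPart (τ : ℝ) (θ : ParamIdx nx nu → ℝ) : ParamIdx nx nu → ℝ :=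
  θ - (selectorD nx nu)ᵀ *ᵥ freePart τ θ

/-- The columns of `M` that belong to free entries; the other ones are zero. -/
noncomputable def freeCols (τ : ℝ) (M : Matrix ((Fin nx × Fin nu) ⊕ Fin nu) (ParamIdx nx nu) ℝ)
    (θ : ParamIdx nx nu → ℝ) : Matrix ((Fin nx × Fin nu) ⊕ Fin nu) (ConstrIdx nx nu) ℝ :=
  M * (selectorD nx nu)ᵀ * freeDiag τ θ

theorem freeDiag_congr {τ : ℝ} {θ θ' : ParamIdx nx nu → ℝ}
    (h : activeSet τ θ' = activeSet τ θ) : freeDiag τ θ' = freeDiag τ θ := by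
  rw [freeDiag, freeDiag, h]

open Classical in
theorem freeDiag_mulVec (τ : ℝ) (θ : ParamIdx nx nu → ℝ) (v : ConstrIdx nx nu → ℝ)
    (j : ConstrIdx nx nu) :
    (freeDiag τ θ *ᵥ v) j = if j ∈ activeSet τ θ then 0 else v j := by
  rw [freeDiag, Matrix.mulVec_diagonal]
  split_ifs <;> simp

theorem freeDiag_mulVec_freePart (τ : ℝ) (θ : ParamIdx nx nu → ℝ) :
    freeDiag τ θ *ᵥ freePart τ θ = freePart τ θ := by
  ext j
  simp only [freePart, freeDiag_mulVec]
  split_ifs <;> rfl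

/-- Puts the objective in the form ‖Gφ + b‖², with φ the free entries and b the contribution of the
fixed ones. -/
theorem mulVec_eq_freeCols_add (τ : ℝ)
    (M : Matrix ((Fin nx × Fin nu) ⊕ Fin nu) (ParamIdx nx nu) ℝ) (θ : ParamIdx nx nu → ℝ) :
    M *ᵥ θ = freeCols τ M θ *ᵥ freePart τ θ + M *ᵥ fixedPart τ θ := by
  rw [freeCols, fixedPart, ← Matrix.mulVec_mulVec, freeDiag_mulVec_freePart, Matrix.mulVec_sub,
    ← Matrix.mulVec_mulVec]
  abel

/-- Active entries equal τ, off-diagonal entries of R vanish and the last entry is 1, so the active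
set leaves no choice for the entries that are not free. -/
theorem fixedPart_congr {τ : ℝ} {θ θ' : ParamIdx nx nu → ℝ} (hθ : IsFeasible τ θ)
    (hθ' : IsFeasible τ θ') (h : activeSet τ θ' = activeSet τ θ) :
    fixedPart τ θ' = fixedPart τ θ := by
  ext p
  simp only [fixedPart, Pi.sub_apply]
  rcases paramIdx_cases p with ⟨j, rfl⟩ | ⟨a, b, hab, rfl⟩ | rfl
  · rw [selectorD_transpose_mulVec_selected, selectorD_transpose_mulVec_selected, freePart,
      freePart, freeDiag_mulVec, freeDiag_mulVec, h]
    split_ifs with hj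
    · have h1 : (selectorD nx nu *ᵥ θ) j = τ := hj
      have h2 : (selectorD nx nu *ᵥ θ') j = τ := by rw [← h] at hj; exact hj
      rw [selectorD_mulVec] at h1 h2
      rw [h1, h2]
    · simp [selectorD_mulVec]
  · rw [selectorD_transpose_mulVec_of_notMem _ (selected_ne_offDiag hab),
      selectorD_transpose_mulVec_of_notMem _ (selected_ne_offDiag hab)]
    have h1 : θ (Sum.inr (Sum.inr (Sum.inl (b, a)))) = 0 := hθ.2.1 a b hab
    have h2 : θ' (Sum.inr (Sum.inr (Sum.inl (b, a)))) = 0 := hθ'.2.1 a b hab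
    rw [h1, h2]
  · rw [selectorD_transpose_mulVec_of_notMem _ selected_ne_last,
      selectorD_transpose_mulVec_of_notMem _ selected_ne_last, hθ.2.2, hθ'.2.2]

theorem sub_eq_of_activeSet_eq {τ : ℝ} {θ θ' : ParamIdx nx nu → ℝ} (hθ : IsFeasible τ θ)
    (hθ' : IsFeasible τ θ') (h : activeSet τ θ' = activeSet τ θ) :
    θ' - θ = (selectorD nx nu)ᵀ *ᵥ (freePart τ θ' - freePart τ θ) := by
  have := fixedPart_congr hθ hθ' h
  simp only [fixedPart] at this
  rw [Matrix.mulVec_sub]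
  rw [sub_eq_sub_iff_add_eq_add] at this ⊢
  rw [this]; abel

/-- Small moves of the free entries keep feasibility and the active set. -/
theorem eventually_isFeasible_and_activeSet_eq {τ : ℝ} {θ : ParamIdx nx nu → ℝ}
    (hθ : IsFeasible τ θ) (v : ConstrIdx nx nu → ℝ) :
    ∀ᶠ s : ℝ in nhds 0,
      IsFeasible τ (θ + s • ((selectorD nx nu)ᵀ *ᵥ (freeDiag τ θ *ᵥ v))) ∧
      activeSet τ (θ + s • ((selectorD nx nu)ᵀ *ᵥ (freeDiag τ θ *ᵥ v))) = activeSet τ θ := by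
  have hval : ∀ (s : ℝ) (j : ConstrIdx nx nu),
      (selectorD nx nu *ᵥ (θ + s • ((selectorD nx nu)ᵀ *ᵥ (freeDiag τ θ *ᵥ v)))) j
        = (selectorD nx nu *ᵥ θ) j + s * (freeDiag τ θ *ᵥ v) j := by
    intro s j
    simp only [selectorD_mulVec, Pi.add_apply, Pi.smul_apply, smul_eq_mul,
      selectorD_transpose_mulVec_selected]
  have hev : ∀ᶠ s : ℝ in nhds 0, ∀ j : ConstrIdx nx nu, j ∉ activeSet τ θ →
      τ < (selectorD nx nu *ᵥ θ) j + s * (freeDiag τ θ *ᵥ v) j := by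
    rw [Filter.eventually_all]
    intro j
    by_cases hj : j ∈ activeSet τ θ
    · simp [hj]
    · have hlt : τ < (selectorD nx nu *ᵥ θ) j :=
        lt_of_le_of_ne (hθ.1 j) (fun h => hj h.symm)
      have hc : Filter.Tendsto
          (fun s : ℝ => (selectorD nx nu *ᵥ θ) j + s * (freeDiag τ θ *ᵥ v) j) (nhds 0)
          (nhds ((selectorD nx nu *ᵥ θ) j)) := by
        have : Continuous
            (fun s : ℝ => (selectorD nx nu *ᵥ θ) j + s * (freeDiag τ θ *ᵥ v) j) := by fun_prop
        simpa using this.tendsto 0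
      filter_upwards [hc.eventually_const_lt hlt] with s hs _ using hs
  filter_upwards [hev] with s hs
  have hact : ∀ j ∈ activeSet τ θ,
      (selectorD nx nu *ᵥ θ) j + s * (freeDiag τ θ *ᵥ v) j = τ := by
    intro j hj
    rw [freeDiag_mulVec, if_pos hj, mul_zero, add_zero]
    exact hj
  refine ⟨⟨fun j => ?_, fun a b hab => ?_, ?_⟩, ?_⟩
  · rw [hval]
    by_cases hj : j ∈ activeSet τ θ
    · exact (hact j hj).ge
    · exact (hs j hj).le
  · have h1 : θ (Sum.inr (Sum.inr (Sum.inl (b, a)))) = 0 := hθ.2.1 a b hab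
    simp only [paramR, Matrix.of_apply, Pi.add_apply, Pi.smul_apply, smul_eq_mul]
    rw [selectorD_transpose_mulVec_of_notMem _ (selected_ne_offDiag hab), h1]
    simp
  · simp only [Pi.add_apply, Pi.smul_apply, smul_eq_mul]
    rw [selectorD_transpose_mulVec_of_notMem _ selected_ne_last, hθ.2.2]
    simp
  · ext j
    change (selectorD nx nu *ᵥ _) j = τ ↔ _
    rw [hval]
    by_cases hj : j ∈ activeSet τ θ
    · simp [hact j hj, hj]
    · simp [(hs j hj).ne', hj]

theorem mulVec_add_smul_free (τ : ℝ)
    (M : Matrix ((Fin nx × Fin nu) ⊕ Fin nu) (ParamIdx nx nu) ℝ) (θ : ParamIdx nx nu → ℝ)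
    (v : ConstrIdx nx nu → ℝ) (s : ℝ) :
    M *ᵥ (θ + s • ((selectorD nx nu)ᵀ *ᵥ (freeDiag τ θ *ᵥ v)))
      = M *ᵥ θ + s • (freeCols τ M θ *ᵥ v) := by
  rw [Matrix.mulVec_add, Matrix.mulVec_smul, freeCols, Matrix.mulVec_mulVec, Matrix.mulVec_mulVec]

/-- The normal equations of the least-squares problem in the free entries. -/
theorem IsLSSolution.inner_freeCols_eq_zero {τ : ℝ}
    {M : Matrix ((Fin nx × Fin nu) ⊕ Fin nu) (ParamIdx nx nu) ℝ} {θ : ParamIdx nx nu → ℝ}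
    (h : IsLSSolution τ M θ) (v : ConstrIdx nx nu → ℝ) :
    ⟪WithLp.toLp 2 (M *ᵥ θ), WithLp.toLp 2 (freeCols τ M θ *ᵥ v)⟫_ℝ = 0 := by
  refine inner_eq_zero_of_eventually_norm_le ?_
  filter_upwards [eventually_isFeasible_and_activeSet_eq h.1 v] with s hs
  have := h.2 _ hs.1
  rw [mulVec_add_smul_free] at this
  exact le_of_sq_le_sq this (norm_nonneg _)

/-- The free entries of a returned solution are orthogonal to the kernel. -/
theorem IsReturnedSolution.inner_freePart_eq_zero {τ : ℝ}
    {M : Matrix ((Fin nx × Fin nu) ⊕ Fin nu) (ParamIdx nx nu) ℝ} {θ : ParamIdx nx nu → ℝ}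
    (h : IsReturnedSolution τ M θ) {v : ConstrIdx nx nu → ℝ} (hv : freeCols τ M θ *ᵥ v = 0) :
    ⟪WithLp.toLp 2 (freePart τ θ), WithLp.toLp 2 v⟫_ℝ = 0 := by
  have h0 : ⟪WithLp.toLp 2 θ,
      WithLp.toLp 2 ((selectorD nx nu)ᵀ *ᵥ (freeDiag τ θ *ᵥ v))⟫_ℝ = 0 := by
    refine inner_eq_zero_of_eventually_norm_le ?_
    filter_upwards [eventually_isFeasible_and_activeSet_eq h.1.1 v] with s hs
    -- A move along the kernel of the free columns leaves M θ unchanged, so the moved point is again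
    -- a solution with the same active set and cannot have smaller norm.
    refine h.2 _ ⟨hs.1, fun θ' hθ' => ?_⟩ hs.2
    change ‖WithLp.toLp 2
      (M *ᵥ (θ + s • ((selectorD nx nu)ᵀ *ᵥ (freeDiag τ θ *ᵥ v))))‖ ^ 2 ≤ _
    rw [mulVec_add_smul_free, hv, smul_zero, add_zero]
    exact h.1.2 θ' hθ'
  rw [EuclideanSpace.inner_toLp_toLp, star_trivial] at h0 ⊢
  rw [dotProduct_comm, Matrix.dotProduct_mulVec, Matrix.vecMul_transpose,
    Matrix.dotProduct_mulVec] at h0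
  rw [dotProduct_comm, ← h0, freePart, ← Matrix.mulVec_transpose, freeDiag,
    Matrix.diagonal_transpose]

/-- Converts entrywise closeness of M into operator-norm closeness of the free columns and closeness
of b. -/
theorem LinearMap.exists_norm_le_of_entries {m n V : Type*} [Fintype m] [Fintype n]
    [NormedAddCommGroup V] [NormedSpace ℝ V] (f : Matrix m n ℝ →ₗ[ℝ] V) :
    ∃ K > 0, ∀ (A : Matrix m n ℝ) (ε : ℝ), 0 ≤ ε → (∀ i j, |A i j| ≤ ε) → ‖f A‖ ≤ K * ε := by
  set g : (m → n → ℝ) →L[ℝ] V :=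
    LinearMap.toContinuousLinearMap (f ∘ₗ (Matrix.ofLinearEquiv ℝ).toLinearMap) with hg
  refine ⟨‖g‖ + 1, by positivity, fun A ε hε hA => ?_⟩
  have h1 : ‖(fun i j => A i j : m → n → ℝ)‖ ≤ ε := by
    rw [pi_norm_le_iff_of_nonneg hε]
    intro i
    rw [pi_norm_le_iff_of_nonneg hε]
    exact fun j => hA i j
  have h2 : f A = g (fun i j => A i j) := rfl
  rw [h2]
  calc _ ≤ ‖g‖ * ε := g.le_opNorm_of_le h1
    _ ≤ _ := by nlinarith

/-- The columns of the free entries as an operator of Euclidean spaces. -/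
noncomputable def freeOp (τ : ℝ) (θ : ParamIdx nx nu → ℝ) :
    Matrix ((Fin nx × Fin nu) ⊕ Fin nu) (ParamIdx nx nu) ℝ →ₗ[ℝ]
      (EuclideanSpace ℝ (ConstrIdx nx nu) →L[ℝ] EuclideanSpace ℝ ((Fin nx × Fin nu) ⊕ Fin nu)) where
  toFun M := LinearMap.toContinuousLinearMap (Matrix.toEuclideanLin (freeCols τ M θ))
  map_add' M M' := by simp [freeCols, Matrix.add_mul]
  map_smul' c M := by simp [freeCols]

theorem finrank_range_freeOp (τ : ℝ)
    (M : Matrix ((Fin nx × Fin nu) ⊕ Fin nu) (ParamIdx nx nu) ℝ) (θ : ParamIdx nx nu → ℝ) :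
    Module.finrank ℝ (freeOp τ θ M).range = freeRank τ M θ := by
  have : freeRank τ M θ = (freeCols τ M θ).rank := rfl
  rw [this, Matrix.rank_eq_finrank_range_toLin _ (PiLp.basisFun 2 ℝ _) (PiLp.basisFun 2 ℝ _),
    ← Matrix.toLpLin_eq_toLin]
  rfl

/-- Returned solutions are locally Lipschitz in the matrix, as long as the active set and the rank
of the free columns do not change. -/
theorem IsReturnedSolution.exists_lipschitz {τ : ℝ}
    {M : Matrix ((Fin nx × Fin nu) ⊕ Fin nu) (ParamIdx nx nu) ℝ} {θ : ParamIdx nx nu → ℝ}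
    (h : IsReturnedSolution τ M θ) :
    ∃ C > 0, ∃ η > 0, ∀ (M' : Matrix ((Fin nx × Fin nu) ⊕ Fin nu) (ParamIdx nx nu) ℝ)
      (θ' : ParamIdx nx nu → ℝ) (ε : ℝ), 0 ≤ ε → ε ≤ η → (∀ p q, |M' p q - M p q| ≤ ε) →
      IsReturnedSolution τ M' θ' → activeSet τ θ' = activeSet τ θ →
      freeRank τ M' θ' = freeRank τ M θ → ‖WithLp.toLp 2 (θ' - θ)‖ ≤ C * ε := by
  obtain ⟨K₁, hK₁, hop⟩ := LinearMap.exists_norm_le_of_entries (freeOp τ θ)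
  obtain ⟨K₂, hK₂, hb⟩ := LinearMap.exists_norm_le_of_entries
    (((WithLp.linearEquiv 2 ℝ (((Fin nx × Fin nu) ⊕ Fin nu) → ℝ)).symm.toLinearMap) ∘ₗ
      ((Matrix.mulVecBilin ℝ ℝ).flip (fixedPart τ θ)))
  obtain ⟨C, hC, η, hη, hmain⟩ := exists_leastNorm_leastSquares_lipschitz (freeOp τ θ M)
    (WithLp.toLp 2 (freePart τ θ)) (WithLp.toLp 2 (M *ᵥ fixedPart τ θ))
    (fun v hv => h.inner_freePart_eq_zero (v := v.ofLp) (by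
      have := congrArg WithLp.ofLp hv
      exact this))
    (fun v => by
      have := h.1.inner_freeCols_eq_zero v.ofLp
      rw [mulVec_eq_freeCols_add τ M θ] at this
      exact this)
  set L : EuclideanSpace ℝ (ConstrIdx nx nu) →L[ℝ] EuclideanSpace ℝ (ParamIdx nx nu) :=
    LinearMap.toContinuousLinearMap (Matrix.toEuclideanLin (selectorD nx nu)ᵀ) with hL
  refine ⟨(‖L‖ + 1) * (C * (K₁ + K₂)), by positivity, η / (K₁ + K₂), by positivity, ?_⟩
  intro M' θ' ε hε0 hεη hM h' hact hrank
  rw [le_div_iff₀ (by positivity)] at hεη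
  -- The free columns depend on the parameters only through the active set, so both problems live on
  -- the same free entries.
  have hcols : freeOp τ θ' = freeOp τ θ := by
    ext1 N
    simp only [freeOp, freeCols, freeDiag_congr hact]
  have hfix := fixedPart_congr h.1.1 h'.1.1 hact
  have key := hmain (freeOp τ θ M') (WithLp.toLp 2 (freePart τ θ'))
    (WithLp.toLp 2 (M' *ᵥ fixedPart τ θ)) ((K₁ + K₂) * ε) (by linarith)
    (by
      rw [← map_sub]
      refine (hop (M' - M) ε hε0 hM).trans ?_
      nlinarith)
    (by
      have h1 := hb (M' - M) ε hε0 hM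
      have h2 : WithLp.toLp 2 (M' *ᵥ fixedPart τ θ) - WithLp.toLp 2 (M *ᵥ fixedPart τ θ)
        = WithLp.toLp 2 ((M' - M) *ᵥ fixedPart τ θ) := by
        rw [Matrix.sub_mulVec]; rfl
      rw [h2]
      refine le_trans h1 ?_
      nlinarith)
    (by rw [← hcols, finrank_range_freeOp, hrank, hcols, finrank_range_freeOp])
    (fun v hv => h'.inner_freePart_eq_zero (v := v.ofLp) (by
      rw [← hcols] at hv
      exact congrArg WithLp.ofLp hv))
    (fun v => by
      have := h'.1.inner_freeCols_eq_zero v.ofLp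
      rw [mulVec_eq_freeCols_add τ M' θ', hfix] at this
      rw [← hcols]
      exact this)
  have hsub : WithLp.toLp 2 (θ' - θ)
      = L (WithLp.toLp 2 (freePart τ θ') - WithLp.toLp 2 (freePart τ θ)) := by
    rw [sub_eq_of_activeSet_eq h.1.1 h'.1.1 hact]
    rfl
  rw [hsub]
  calc _ ≤ ‖L‖ * (C * ((K₁ + K₂) * ε)) := L.le_opNorm_of_le key
    _ ≤ (‖L‖ + 1) * (C * ((K₁ + K₂) * ε)) := by gcongr; linarith
    _ = _ := by ring

end LeastSquares

/-! ### Error propagation through the backward recursion, in O-notation along a filter. -/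

section Perturbation

open Filter Asymptotics

variable {X : Type*} {l : Filter X} {g : X → ℝ}

/-- `f` deviates from the constant `a` by `O(g)` along `l`. -/
def DeviatesBy (l : Filter X) (g : X → ℝ) (f : X → ℝ) (a : ℝ) : Prop :=
  (fun x => f x - a) =O[l] g

namespace DeviatesBy

variable {f h : X → ℝ} {a b : ℝ}

theorem const (a : ℝ) : DeviatesBy l g (fun _ => a) a := by
  simp only [DeviatesBy, sub_self]
  exact isBigO_zero _ _

theorem add (hf : DeviatesBy l g f a) (hh : DeviatesBy l g h b) :
    DeviatesBy l g (fun x => f x + h x) (a + b) := by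
  refine (IsBigO.add hf hh).congr_left fun x => ?_
  ring

theorem neg (hf : DeviatesBy l g f a) : DeviatesBy l g (fun x => -f x) (-a) := by
  refine (IsBigO.neg_left hf).congr_left fun x => ?_
  ring

theorem sub (hf : DeviatesBy l g f a) (hh : DeviatesBy l g h b) :
    DeviatesBy l g (fun x => f x - h x) (a - b) := by
  simpa only [sub_eq_add_neg] using hf.add hh.neg

theorem tendsto (hf : DeviatesBy l g f a) (hg : Tendsto g l (nhds 0)) :
    Tendsto f l (nhds a) := by
  have := (IsBigO.trans_tendsto hf hg).add_const a
  simpa using this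

theorem mul (hg : Tendsto g l (nhds 0)) (hf : DeviatesBy l g f a) (hh : DeviatesBy l g h b) :
    DeviatesBy l g (fun x => f x * h x) (a * b) := by
  have h1 : (fun x => (f x - a) * h x) =O[l] g := by
    have := IsBigO.mul hf ((hh.tendsto hg).isBigO_one ℝ)
    simpa using this
  have h2 : (fun x => a * (h x - b)) =O[l] g := IsBigO.const_mul_left hh a
  refine (h1.add h2).congr_left fun x => ?_
  ring

theorem inv (hg : Tendsto g l (nhds 0)) (hf : DeviatesBy l g f a) (ha : a ≠ 0) :
    DeviatesBy l g (fun x => (f x)⁻¹) a⁻¹ := by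
  have h0 := hf.tendsto hg
  have h1 : (fun x => -(f x)⁻¹ * a⁻¹ * (f x - a)) =O[l] g := by
    have h2 : (fun x => -(f x)⁻¹ * a⁻¹) =O[l] (fun _ => (1 : ℝ)) :=
      (((h0.inv₀ ha).neg).mul_const a⁻¹).isBigO_one ℝ
    simpa using h2.mul hf
  refine IsBigO.congr' h1 ?_ EventuallyEq.rfl
  filter_upwards [h0.eventually_ne ha] with x hx
  field_simp
  ring

theorem sum {ι : Type*} {s : Finset ι} {f : ι → X → ℝ} {a : ι → ℝ}
    (hf : ∀ i ∈ s, DeviatesBy l g (f i) (a i)) :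
    DeviatesBy l g (fun x => ∑ i ∈ s, f i x) (∑ i ∈ s, a i) := by
  have : (fun x => ∑ i ∈ s, (f i x - a i)) =O[l] g := IsBigO.fun_sum hf
  refine this.congr_left fun x => ?_
  rw [Finset.sum_sub_distrib]

theorem prod (hg : Tendsto g l (nhds 0)) {ι : Type*} {s : Finset ι} {f : ι → X → ℝ} {a : ι → ℝ}
    (hf : ∀ i ∈ s, DeviatesBy l g (f i) (a i)) :
    DeviatesBy l g (fun x => ∏ i ∈ s, f i x) (∏ i ∈ s, a i) := by
  classical
  induction s using Finset.induction_on with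
  | empty => simpa using const 1
  | insert i s hi ih =>
    simp only [Finset.prod_insert hi]
    exact mul hg (hf i (Finset.mem_insert_self _ _))
      (ih fun j hj => hf j (Finset.mem_insert_of_mem hj))

end DeviatesBy

/-- Entrywise version of `DeviatesBy` for matrices. -/
def MatDeviatesBy {m n : Type*} (l : Filter X) (g : X → ℝ) (A : X → Matrix m n ℝ)
    (A₀ : Matrix m n ℝ) : Prop :=
  ∀ i j, DeviatesBy l g (fun x => A x i j) (A₀ i j)

/-- Entrywise version of `DeviatesBy` for vectors. -/
def VecDeviatesBy {m : Type*} (l : Filter X) (g : X → ℝ) (v : X → m → ℝ) (v₀ : m → ℝ) : Prop :=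
  ∀ i, DeviatesBy l g (fun x => v x i) (v₀ i)

namespace MatDeviatesBy

variable {m n p q : Type*} {A B : X → Matrix m n ℝ} {A₀ B₀ : Matrix m n ℝ}

theorem const (A₀ : Matrix m n ℝ) : MatDeviatesBy l g (fun _ => A₀) A₀ :=
  fun _ _ => DeviatesBy.const _

theorem add (hA : MatDeviatesBy l g A A₀) (hB : MatDeviatesBy l g B B₀) :
    MatDeviatesBy l g (fun x => A x + B x) (A₀ + B₀) := fun i j => (hA i j).add (hB i j)

theorem sub (hA : MatDeviatesBy l g A A₀) (hB : MatDeviatesBy l g B B₀) :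
    MatDeviatesBy l g (fun x => A x - B x) (A₀ - B₀) := fun i j => (hA i j).sub (hB i j)

theorem neg (hA : MatDeviatesBy l g A A₀) :
    MatDeviatesBy l g (fun x => -A x) (-A₀) := fun i j => (hA i j).neg

theorem transpose (hA : MatDeviatesBy l g A A₀) :
    MatDeviatesBy l g (fun x => (A x)ᵀ) A₀ᵀ := fun i j => hA j i

theorem sum {ι : Type*} {s : Finset ι} {A : ι → X → Matrix m n ℝ} {A₀ : ι → Matrix m n ℝ}
    (hA : ∀ i ∈ s, MatDeviatesBy l g (A i) (A₀ i)) :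
    MatDeviatesBy l g (fun x => ∑ i ∈ s, A i x) (∑ i ∈ s, A₀ i) := by
  intro i j
  simp only [Matrix.sum_apply]
  exact DeviatesBy.sum fun k hk => hA k hk i j

theorem mul [Fintype n] (hg : Tendsto g l (nhds 0)) (hA : MatDeviatesBy l g A A₀)
    {C : X → Matrix n p ℝ} {C₀ : Matrix n p ℝ} (hC : MatDeviatesBy l g C C₀) :
    MatDeviatesBy l g (fun x => A x * C x) (A₀ * C₀) := by
  intro i j
  simp only [Matrix.mul_apply]
  exact DeviatesBy.sum fun k _ => DeviatesBy.mul hg (hA i k) (hC k j)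

theorem mulVec [Fintype n] (hg : Tendsto g l (nhds 0)) (hA : MatDeviatesBy l g A A₀)
    {v : X → n → ℝ} {v₀ : n → ℝ} (hv : VecDeviatesBy l g v v₀) :
    VecDeviatesBy l g (fun x => A x *ᵥ v x) (A₀ *ᵥ v₀) := by
  intro i
  simp only [Matrix.mulVec, dotProduct]
  exact DeviatesBy.sum fun k _ => DeviatesBy.mul hg (hA i k) (hv k)

theorem vec (hA : MatDeviatesBy l g A A₀) :
    VecDeviatesBy l g (fun x => (A x).vec) A₀.vec := fun ⟨i, j⟩ => hA j i

theorem kronecker (hg : Tendsto g l (nhds 0)) (hA : MatDeviatesBy l g A A₀)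
    {C : X → Matrix p q ℝ} {C₀ : Matrix p q ℝ} (hC : MatDeviatesBy l g C C₀) :
    MatDeviatesBy l g (fun x => A x ⊗ₖ C x) (A₀ ⊗ₖ C₀) :=
  fun i j => DeviatesBy.mul hg (hA i.1 j.1) (hC i.2 j.2)

theorem fromRows (hA : MatDeviatesBy l g A A₀)
    {C : X → Matrix p n ℝ} {C₀ : Matrix p n ℝ} (hC : MatDeviatesBy l g C C₀) :
    MatDeviatesBy l g (fun x => Matrix.fromRows (A x) (C x)) (Matrix.fromRows A₀ C₀) := by
  rintro (i | i) j
  · exact hA i j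
  · exact hC i j

theorem fromCols (hA : MatDeviatesBy l g A A₀)
    {C : X → Matrix m p ℝ} {C₀ : Matrix m p ℝ} (hC : MatDeviatesBy l g C C₀) :
    MatDeviatesBy l g (fun x => Matrix.fromCols (A x) (C x)) (Matrix.fromCols A₀ C₀) := by
  rintro i (j | j)
  · exact hA i j
  · exact hC i j

theorem det [Fintype n] [DecidableEq n] (hg : Tendsto g l (nhds 0)) {A : X → Matrix n n ℝ}
    {A₀ : Matrix n n ℝ} (hA : MatDeviatesBy l g A A₀) :
    DeviatesBy l g (fun x => (A x).det) A₀.det := by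
  simp only [Matrix.det_apply']
  exact DeviatesBy.sum fun σ _ => DeviatesBy.mul hg (DeviatesBy.const _)
    (DeviatesBy.prod hg fun i _ => hA _ _)

/-- The inverse is det⁻¹ times the adjugate, and both factors are built from determinants of
matrices of entries. Only the limit matrix has to be invertible: the determinants nearby are then
eventually nonzero. -/
theorem inv [Fintype n] [DecidableEq n] (hg : Tendsto g l (nhds 0)) {A : X → Matrix n n ℝ}
    {A₀ : Matrix n n ℝ} (hA : MatDeviatesBy l g A A₀) (hu : IsUnit A₀) :
    MatDeviatesBy l g (fun x => (A x)⁻¹) A₀⁻¹ := by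
  have hdet : A₀.det ≠ 0 := ((Matrix.isUnit_iff_isUnit_det _).1 hu).ne_zero
  have hadj : MatDeviatesBy l g (fun x => (A x).adjugate) A₀.adjugate := by
    intro i j
    simp only [Matrix.adjugate_apply]
    refine det hg fun a b => ?_
    simp only [Matrix.updateRow_apply]
    split_ifs
    · exact DeviatesBy.const _
    · exact hA a b
  intro i j
  simp only [Matrix.inv_def, Ring.inverse_eq_inv', Matrix.smul_apply, smul_eq_mul]
  exact DeviatesBy.mul hg (DeviatesBy.inv hg (det hg hA) hdet) (hadj i j)

end MatDeviatesBy

namespace VecDeviatesBy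

variable {m : Type*} {v w : X → m → ℝ} {v₀ w₀ : m → ℝ}

theorem const (v₀ : m → ℝ) : VecDeviatesBy l g (fun _ => v₀) v₀ := fun _ => DeviatesBy.const _

theorem add (hv : VecDeviatesBy l g v v₀) (hw : VecDeviatesBy l g w w₀) :
    VecDeviatesBy l g (fun x => v x + w x) (v₀ + w₀) := fun i => (hv i).add (hw i)

theorem sub (hv : VecDeviatesBy l g v v₀) (hw : VecDeviatesBy l g w w₀) :
    VecDeviatesBy l g (fun x => v x - w x) (v₀ - w₀) := fun i => (hv i).sub (hw i)

theorem sum {ι : Type*} {s : Finset ι} {v : ι → X → m → ℝ} {v₀ : ι → m → ℝ}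
    (hv : ∀ i ∈ s, VecDeviatesBy l g (v i) (v₀ i)) :
    VecDeviatesBy l g (fun x => ∑ i ∈ s, v i x) (∑ i ∈ s, v₀ i) := by
  intro i
  simp only [Finset.sum_apply]
  exact DeviatesBy.sum fun k hk => hv k hk i

theorem replicateCol (hv : VecDeviatesBy l g v v₀) :
    MatDeviatesBy l g (fun x => Matrix.replicateCol Unit (v x)) (Matrix.replicateCol Unit v₀) :=
  fun i _ => hv i

end VecDeviatesBy

/-! ### Stability of the identified parameters in the policies. -/

section Identification

variable {N nx nu : ℕ} {T : ℕ} {dyn : LinearDynamics N nx nu} {pol : AffinePolicy N nx nu}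
  {pol' : X → AffinePolicy N nx nu}

/-- Entrywise `O(g)` deviation of all policies up to the horizon `T`. -/
def PolicyDeviatesBy (l : Filter X) (g : X → ℝ) (T : ℕ) (pol' : X → AffinePolicy N nx nu)
    (pol : AffinePolicy N nx nu) : Prop :=
  ∀ t < T, ∀ i, MatDeviatesBy l g (fun x => (pol' x).K t i) (pol.K t i) ∧
    VecDeviatesBy l g (fun x => (pol' x).α t i) (pol.α t i)

namespace PolicyDeviatesBy

theorem closedLoop (hg : Tendsto g l (nhds 0)) (h : PolicyDeviatesBy l g T pol' pol) {t : ℕ}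
    (ht : t < T) :
    MatDeviatesBy l g (fun x => _root_.closedLoop dyn (pol' x) t) (_root_.closedLoop dyn pol t) :=
  (MatDeviatesBy.const _).sub (MatDeviatesBy.sum fun j _ =>
    (MatDeviatesBy.const _).mul hg (h t ht j).1)

theorem drift (hg : Tendsto g l (nhds 0)) (h : PolicyDeviatesBy l g T pol' pol) {t : ℕ}
    (ht : t < T) :
    VecDeviatesBy l g (fun x => _root_.drift dyn (pol' x) t) (_root_.drift dyn pol t) :=
  VecDeviatesBy.sum fun j _ => (MatDeviatesBy.const _).mulVec hg (h t ht j).2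

theorem matS (hg : Tendsto g l (nhds 0)) (h : PolicyDeviatesBy l g T pol' pol) {t : ℕ}
    (ht : t < T) (i : Fin N) :
    MatDeviatesBy l g (fun x => _root_.matS dyn (pol' x) t i) (_root_.matS dyn pol t i) :=
  (h.closedLoop hg ht).transpose.kronecker hg (MatDeviatesBy.const _)

theorem vecE (hg : Tendsto g l (nhds 0)) (h : PolicyDeviatesBy l g T pol' pol) {t : ℕ}
    (ht : t < T) (hF : IsUnit (_root_.closedLoop dyn pol t)) (i : Fin N) :
    VecDeviatesBy l g (fun x => _root_.vecE dyn (pol' x) t i) (_root_.vecE dyn pol t i) :=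
  (((h t ht i).1.mul hg ((h.closedLoop hg ht).inv hg hF)).mulVec hg (h.drift hg ht)).add
    (h t ht i).2

variable {θ : ℕ → Fin N → ParamIdx nx nu → ℝ} {θ' : X → ℕ → Fin N → ParamIdx nx nu → ℝ}

theorem deltaBack_succ (hg : Tendsto g l (nhds 0)) (h : PolicyDeviatesBy l g T pol' pol) {k : ℕ}
    (hk : k < T) (i : Fin N)
    (hΔ : MatDeviatesBy l g (fun x => deltaBack T dyn (pol' x) (θ' x) i k)
      (deltaBack T dyn pol θ i k))
    (hθ : VecDeviatesBy l g (fun x => θ' x (T - (k + 1) + 1) i) (θ (T - (k + 1) + 1) i)) :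
    MatDeviatesBy l g (fun x => deltaBack T dyn (pol' x) (θ' x) i (k + 1))
      (deltaBack T dyn pol θ i (k + 1)) := by
  have ht : T - (k + 1) < T := by omega
  have hQ : MatDeviatesBy l g (fun x => paramQ (θ' x (T - (k + 1) + 1) i))
    (paramQ (θ (T - (k + 1) + 1) i)) := fun a b => hθ _
  have hR : MatDeviatesBy l g (fun x => paramR (θ' x (T - (k + 1) + 1) i))
    (paramR (θ (T - (k + 1) + 1) i)) := fun a b => hθ _
  have hF := h.closedLoop (dyn := dyn) hg ht
  have hK := (h _ ht i).1
  exact ((hF.transpose.mul hg (hΔ.add hQ)).mul hg hF).add ((hK.transpose.mul hg hR).mul hg hK)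

theorem omegaBack_succ (hg : Tendsto g l (nhds 0)) (h : PolicyDeviatesBy l g T pol' pol) {k : ℕ}
    (hk : k < T) (i : Fin N)
    (hΔ : MatDeviatesBy l g (fun x => deltaBack T dyn (pol' x) (θ' x) i k)
      (deltaBack T dyn pol θ i k))
    (hΩ : VecDeviatesBy l g (fun x => omegaBack T dyn (pol' x) (θ' x) i k)
      (omegaBack T dyn pol θ i k))
    (hθ : VecDeviatesBy l g (fun x => θ' x (T - (k + 1) + 1) i) (θ (T - (k + 1) + 1) i)) :
    VecDeviatesBy l g (fun x => omegaBack T dyn (pol' x) (θ' x) i (k + 1))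
      (omegaBack T dyn pol θ i (k + 1)) := by
  have ht : T - (k + 1) < T := by omega
  have hQ : MatDeviatesBy l g (fun x => paramQ (θ' x (T - (k + 1) + 1) i))
    (paramQ (θ (T - (k + 1) + 1) i)) := fun a b => hθ _
  have hL : VecDeviatesBy l g (fun x => paramL (θ' x (T - (k + 1) + 1) i))
    (paramL (θ (T - (k + 1) + 1) i)) := fun a => hθ _
  have hR : MatDeviatesBy l g (fun x => paramR (θ' x (T - (k + 1) + 1) i))
    (paramR (θ (T - (k + 1) + 1) i)) := fun a b => hθ _
  have hF := h.closedLoop (dyn := dyn) hg ht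
  exact (hF.transpose.mulVec hg
      ((hΩ.add hL).sub ((hΔ.add hQ).mulVec hg (h.drift hg ht)))).add
    (((h _ ht i).1.transpose.mul hg hR).mulVec hg (h _ ht i).2)

theorem matM (hg : Tendsto g l (nhds 0)) (h : PolicyDeviatesBy l g T pol' pol) {t : ℕ}
    (ht : t - 1 < T) (hF : IsUnit (_root_.closedLoop dyn pol (t - 1))) (i : Fin N)
    (hΔ : MatDeviatesBy l g (fun x => deltaBack T dyn (pol' x) (θ' x) i (T - t))
      (deltaBack T dyn pol θ i (T - t)))
    (hΩ : VecDeviatesBy l g (fun x => omegaBack T dyn (pol' x) (θ' x) i (T - t))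
      (omegaBack T dyn pol θ i (T - t))) :
    MatDeviatesBy l g (fun x => _root_.matM T dyn (pol' x) (θ' x) t i)
      (_root_.matM T dyn pol θ t i) := by
  have hE := h.vecE hg ht hF i
  refine MatDeviatesBy.fromRows
    ((h.matS hg ht i).fromCols ((MatDeviatesBy.const _).fromCols (MatDeviatesBy.fromCols
      (((h _ ht i).1.transpose.kronecker hg (MatDeviatesBy.const _)).neg)
      ((h.matS hg ht i).mulVec hg hΔ.vec).replicateCol)))
    ((MatDeviatesBy.const _).fromCols ((MatDeviatesBy.const _).fromCols (MatDeviatesBy.fromCols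
      (MatDeviatesBy.neg ?_) ((MatDeviatesBy.const _).mulVec hg hΩ).replicateCol)))
  exact fun a b => DeviatesBy.mul hg (hE b.1) (DeviatesBy.const _)

end PolicyDeviatesBy

theorem IsReturnedSolution.vecDeviatesBy {τ : ℝ} (hg : Tendsto g l (nhds 0))
    {M : Matrix ((Fin nx × Fin nu) ⊕ Fin nu) (ParamIdx nx nu) ℝ} {θ : ParamIdx nx nu → ℝ}
    (h : IsReturnedSolution τ M θ)
    {M' : X → Matrix ((Fin nx × Fin nu) ⊕ Fin nu) (ParamIdx nx nu) ℝ}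
    {θ' : X → ParamIdx nx nu → ℝ} (hM : MatDeviatesBy l g M' M)
    (h' : ∀ᶠ x in l, IsReturnedSolution τ (M' x) (θ' x) ∧ activeSet τ (θ' x) = activeSet τ θ ∧
      freeRank τ (M' x) (θ' x) = freeRank τ M θ) :
    (fun x => WithLp.toLp 2 (θ' x - θ)) =O[l] g := by
  obtain ⟨C, hC, η, hη, hlip⟩ := h.exists_lipschitz
  -- The sum of all entry errors dominates each of them and is itself O(g), so it can serve as ε in
  -- the Lipschitz estimate.
  set S : X → ℝ := fun x => ∑ p, ∑ q, |M' x p q - M p q| with hS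
  have hSO : S =O[l] g := IsBigO.fun_sum fun p _ => IsBigO.fun_sum fun q _ => (hM p q).abs_left
  have hS0 : Tendsto S l (nhds 0) := hSO.trans_tendsto hg
  refine IsBigO.trans (IsBigO.of_bound C ?_) hSO
  filter_upwards [h', hS0.eventually_le_const hη] with x hx hxS
  have hSnn : 0 ≤ S x := Finset.sum_nonneg fun _ _ => Finset.sum_nonneg fun _ _ => abs_nonneg _
  rw [Real.norm_of_nonneg hSnn]
  refine hlip (M' x) (θ' x) (S x) hSnn hxS (fun p q => ?_) hx.1 hx.2.1 hx.2.2
  calc |M' x p q - M p q| ≤ ∑ q, |M' x p q - M p q| :=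
        Finset.single_le_sum (f := fun q => |M' x p q - M p q|) (fun _ _ => abs_nonneg _)
          (Finset.mem_univ q)
    _ ≤ S x := Finset.single_le_sum (f := fun p => ∑ q, |M' x p q - M p q|)
          (fun _ _ => Finset.sum_nonneg fun _ _ => abs_nonneg _) (Finset.mem_univ p)

theorem vecDeviatesBy_of_toLp_isBigO {m : Type*} [Fintype m] {v : X → m → ℝ} {v₀ : m → ℝ}
    (h : (fun x => WithLp.toLp 2 (v x - v₀)) =O[l] g) : VecDeviatesBy l g v v₀ := by
  intro i
  refine IsBigO.trans (IsBigO.of_bound 1 (Eventually.of_forall fun x => ?_)) h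
  rw [one_mul]
  exact PiLp.norm_apply_le (WithLp.toLp 2 (v x - v₀)) i

/-- Error propagation through the backward algorithm. -/
theorem identified_deviation (hg : Tendsto g l (nhds 0)) {τ : ℝ}
    (hF : ∀ t < T, IsUnit (closedLoop dyn pol t)) (h : PolicyDeviatesBy l g T pol' pol)
    {θ : ℕ → Fin N → ParamIdx nx nu → ℝ} {θ' : X → ℕ → Fin N → ParamIdx nx nu → ℝ}
    (hθ : IsIdentified T τ dyn pol θ)
    (hθ' : ∀ᶠ x in l, IsIdentified T τ dyn (pol' x) (θ' x))
    (hgood : ∀ᶠ x in l, ∀ r, 1 ≤ r → r ≤ T → ∀ j,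
      activeSet τ (θ' x r j) = activeSet τ (θ r j) ∧
      freeRank τ (matM T dyn (pol' x) (θ' x) r j) (θ' x r j)
        = freeRank τ (matM T dyn pol θ r j) (θ r j)) (i : Fin N) :
    ∀ t, 1 ≤ t → t ≤ T → (fun x => WithLp.toLp 2 (θ' x t i - θ t i)) =O[l] g := by
  -- Here k = T - t is the backward time. The matrix M_t needs only Δ_t and Ω_t besides the
  -- policies, so control of these two at stage k gives control of θ_t.
  have step : ∀ k, k < T →
      MatDeviatesBy l g (fun x => deltaBack T dyn (pol' x) (θ' x) i k)
        (deltaBack T dyn pol θ i k) →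
      VecDeviatesBy l g (fun x => omegaBack T dyn (pol' x) (θ' x) i k)
        (omegaBack T dyn pol θ i k) →
      (fun x => WithLp.toLp 2 (θ' x (T - k) i - θ (T - k) i)) =O[l] g := by
    intro k hk hΔ hΩ
    have hTk : T - (T - k) = k := by omega
    refine (hθ (T - k) (by omega) (by omega) i).vecDeviatesBy hg
      (h.matM (t := T - k) hg (by omega) (hF _ (by omega)) i (by rwa [hTk]) (by rwa [hTk])) ?_
    filter_upwards [hθ', hgood] with x hx hx'
    exact ⟨hx _ (by omega) (by omega) i, hx' _ (by omega) (by omega) i⟩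
  have hrec : ∀ k, k < T →
      MatDeviatesBy l g (fun x => deltaBack T dyn (pol' x) (θ' x) i k)
        (deltaBack T dyn pol θ i k) ∧
      VecDeviatesBy l g (fun x => omegaBack T dyn (pol' x) (θ' x) i k)
        (omegaBack T dyn pol θ i k) := by
    intro k
    induction k with
    | zero => exact fun _ => ⟨MatDeviatesBy.const _, VecDeviatesBy.const _⟩
    | succ k ih =>
      intro hk
      obtain ⟨hΔ, hΩ⟩ := ih (by omega)
      have h1 := vecDeviatesBy_of_toLp_isBigO (step k (by omega) hΔ hΩ)
      -- The recursion step to k + 1 reads the parameters of the time just treated, namely T - k.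
      rw [show T - k = T - (k + 1) + 1 by omega] at h1
      exact ⟨h.deltaBack_succ hg (by omega) i hΔ h1, h.omegaBack_succ hg (by omega) i hΔ hΩ h1⟩
  intro t ht1 htT
  have := hrec (T - t) (by omega)
  have h2 := step (T - t) (by omega) this.1 this.2
  rwa [show T - (T - t) = t by omega] at h2

/-- The matrix `[K', α'] - [K, α]`. -/
noncomputable def policyDiff (pol' pol : AffinePolicy N nx nu) (t : ℕ) (i : Fin N) :
    Matrix (Fin nu) (Fin nx ⊕ Unit) ℝ :=
  Matrix.fromCols (pol'.K t i) (Matrix.replicateCol Unit (pol'.α t i))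
    - Matrix.fromCols (pol.K t i) (Matrix.replicateCol Unit (pol.α t i))

open scoped Matrix.Norms.Frobenius in
theorem policyError_nonneg (pol' pol : AffinePolicy N nx nu) (t : ℕ) (i : Fin N) :
    0 ≤ policyError pol' pol t i :=
  norm_nonneg (policyDiff pol' pol t i)

open scoped Matrix.Norms.Frobenius in
theorem policyError_sq (pol' pol : AffinePolicy N nx nu) (t : ℕ) (i : Fin N) :
    policyError pol' pol t i ^ 2 = ∑ a, ∑ q, policyDiff pol' pol t i a q ^ 2 := by
  have h : policyError pol' pol t i = ‖policyDiff pol' pol t i‖ := rfl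
  rw [h, Matrix.frobenius_norm_def, ← Real.sqrt_eq_rpow, Real.sq_sqrt (by positivity)]
  simp

theorem abs_policyDiff_le (pol' pol : AffinePolicy N nx nu) (t : ℕ) (i : Fin N) (a : Fin nu)
    (q : Fin nx ⊕ Unit) : |policyDiff pol' pol t i a q| ≤ policyError pol' pol t i := by
  refine abs_le_of_sq_le_sq ?_ (policyError_nonneg _ _ _ _)
  rw [policyError_sq]
  calc policyDiff pol' pol t i a q ^ 2 ≤ ∑ q, policyDiff pol' pol t i a q ^ 2 :=
        Finset.single_le_sum (f := fun q => policyDiff pol' pol t i a q ^ 2)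
          (fun _ _ => sq_nonneg _) (Finset.mem_univ q)
    _ ≤ _ := Finset.single_le_sum (f := fun a => ∑ q, policyDiff pol' pol t i a q ^ 2)
          (fun _ _ => Finset.sum_nonneg fun _ _ => sq_nonneg _) (Finset.mem_univ a)

/-- The parameters found by the backward algorithm are locally Lipschitz in the policies. -/
theorem exists_identified_lipschitz {τ : ℝ} (hF : ∀ t < T, IsUnit (closedLoop dyn pol t))
    {θ : ℕ → Fin N → ParamIdx nx nu → ℝ} (hθ : IsIdentified T τ dyn pol θ) :
    ∃ C > 0, ∃ ε₀ > 0, ∀ (ε : ℝ) (pol' : AffinePolicy N nx nu)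
      (θ' : ℕ → Fin N → ParamIdx nx nu → ℝ), 0 < ε → ε ≤ ε₀ →
      (∀ t < T, ∀ i, policyError pol' pol t i ≤ ε) → IsIdentified T τ dyn pol' θ' →
      (∀ r, 1 ≤ r → r ≤ T → ∀ j,
        activeSet τ (θ' r j) = activeSet τ (θ r j) ∧
        freeRank τ (matM T dyn pol' θ' r j) (θ' r j)
          = freeRank τ (matM T dyn pol θ r j) (θ r j)) →
      ∀ t, 1 ≤ t → t ≤ T → ∀ i, ‖WithLp.toLp 2 (θ' t i - θ t i)‖ ≤ C * ε := by
  -- Uniform constants come from the choice of the filter: it lives on all triples (ε, policy,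
  -- parameters) that satisfy the hypotheses and lets only ε tend to 0. An O(ε) bound along it holds
  -- with one C and one neighbourhood of 0 for all admissible triples.
  let Y := ℝ × AffinePolicy N nx nu × (ℕ → Fin N → ParamIdx nx nu → ℝ)
  let S : Set Y := {y | (∀ t < T, ∀ i, policyError y.2.1 pol t i ≤ y.1) ∧
    IsIdentified T τ dyn y.2.1 y.2.2 ∧ ∀ r, 1 ≤ r → r ≤ T → ∀ j,
        activeSet τ (y.2.2 r j) = activeSet τ (θ r j) ∧
        freeRank τ (matM T dyn y.2.1 y.2.2 r j) (y.2.2 r j)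
          = freeRank τ (matM T dyn pol θ r j) (θ r j)}
  let L : Filter Y := comap Prod.fst (nhds 0) ⊓ 𝓟 S
  have hg : Tendsto (Prod.fst : Y → ℝ) L (nhds 0) := tendsto_comap.mono_left inf_le_left
  have hS : ∀ᶠ y in L, y ∈ S := eventually_inf_principal.2 (Eventually.of_forall fun y hy => hy)
  have hpol : PolicyDeviatesBy L (Prod.fst : Y → ℝ) T (fun y => y.2.1) pol := by
    intro t ht i
    constructor
    · intro a b
      refine IsBigO.of_bound 1 ?_
      filter_upwards [hS] with y hy
      rw [one_mul]
      exact ((abs_policyDiff_le _ _ t i a (Sum.inl b)).trans (hy.1 t ht i)).trans (le_abs_self _)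
    · intro a
      refine IsBigO.of_bound 1 ?_
      filter_upwards [hS] with y hy
      rw [one_mul]
      exact ((abs_policyDiff_le _ _ t i a (Sum.inr ())).trans (hy.1 t ht i)).trans (le_abs_self _)
  have key : ∀ t ∈ Finset.Icc 1 T, ∀ i, (fun y : Y => WithLp.toLp 2 (y.2.2 t i - θ t i)) =O[L]
      (Prod.fst : Y → ℝ) := fun t ht i =>
    identified_deviation hg hF hpol hθ (hS.mono fun y hy => hy.2.1) (hS.mono fun y hy => hy.2.2) i
      t (Finset.mem_Icc.1 ht).1 (Finset.mem_Icc.1 ht).2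
  have hsum : (fun y : Y => ∑ t ∈ Finset.Icc 1 T, ∑ i, ‖WithLp.toLp 2 (y.2.2 t i - θ t i)‖) =O[L]
      (Prod.fst : Y → ℝ) := IsBigO.fun_sum fun t ht => IsBigO.fun_sum fun i _ => (key t ht i).norm_left
  obtain ⟨C, hC, hbound⟩ := hsum.exists_pos
  rw [IsBigOWith_def, eventually_inf_principal, eventually_comap, Metric.eventually_nhds_iff]
    at hbound
  obtain ⟨η, hη, hbound⟩ := hbound
  -- Halving η turns the open condition |ε| < η into ε ≤ ε₀.
  refine ⟨C, hC, η / 2, by positivity, fun ε pol' θ' hε hεη hp hid hgd t ht1 htT i => ?_⟩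
  have h1 := hbound (y := ε) (by rw [Real.dist_eq, sub_zero, abs_of_pos hε]; linarith)
    (ε, pol', θ') rfl ⟨hp, hid, hgd⟩
  have hnn : ∀ t, 0 ≤ ∑ i, ‖WithLp.toLp 2 (θ' t i - θ t i)‖ :=
    fun t => Finset.sum_nonneg fun _ _ => norm_nonneg _
  rw [Real.norm_of_nonneg (Finset.sum_nonneg fun t _ => hnn t), Real.norm_of_nonneg hε.le] at h1
  refine le_trans ?_ h1
  calc ‖WithLp.toLp 2 (θ' t i - θ t i)‖ ≤ ∑ i, ‖WithLp.toLp 2 (θ' t i - θ t i)‖ :=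
        Finset.single_le_sum (f := fun i => ‖WithLp.toLp 2 (θ' t i - θ t i)‖)
          (fun _ _ => norm_nonneg _) (Finset.mem_univ i)
    _ ≤ _ := Finset.single_le_sum (f := fun t => ∑ i, ‖WithLp.toLp 2 (θ' t i - θ t i)‖)
          (fun t _ => hnn t) (Finset.mem_Icc.2 ⟨ht1, htT⟩)

end Identification

end Perturbation

/-! ### Chernoff and Hoeffding bounds, and products with sub-Gaussian noise. -/

section Concentration

variable {Ω : Type*} [MeasurableSpace Ω] {P : Measure Ω}

/-- Chernoff bound for sums of independent variables whose moment generating functions are bounded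
by a Gaussian one near zero. -/
theorem measureReal_abs_sum_ge_le_of_mgf_le [IsProbabilityMeasure P] {n : ℕ} {X : Fin n → Ω → ℝ}
    (hind : iIndepFun X P) (hm : ∀ s, AEMeasurable (X s) P) {a C η : ℝ} (ha : 0 < a)
    (haC : a * C ≤ 1 / 2) (hη : 0 < η) (hη1 : η ≤ 1)
    (hint : ∀ s t, |t| ≤ a → Integrable (fun ω => Real.exp (t * X s ω)) P)
    (hmgf : ∀ s t, |t| ≤ a → mgf (X s) P t ≤ Real.exp (C * t ^ 2)) :
    P.real {ω | n * η ≤ |∑ s, X s ω|} ≤ 2 * Real.exp (-(n * (a / 2) * η ^ 2)) := by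
  have hsum : ∀ t, |t| ≤ a → mgf (∑ s, X s) P t ≤ Real.exp (n * (C * t ^ 2)) := by
    intro t ht
    rw [hind.mgf_sum₀ hm]
    calc ∏ s, mgf (X s) P t ≤ ∏ _s : Fin n, Real.exp (C * t ^ 2) :=
          Finset.prod_le_prod (fun s _ => mgf_nonneg) (fun s _ => hmgf s t ht)
      _ = _ := by simp [← Real.exp_nat_mul]
  have hsint : ∀ t, |t| ≤ a → Integrable (fun ω => Real.exp (t * (∑ s, X s) ω)) P := by
    intro t ht
    have hae : ∀ s, X s =ᵐ[P] (hm s).mk (X s) := fun s => (hm s).ae_eq_mk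
    have h1 := (hind.congr hae).integrable_exp_mul_sum (t := t) (s := Finset.univ)
      (fun s => (hm s).measurable_mk) (fun s _ => (hint s t ht).congr
        ((hae s).mono fun ω hω => by simp only [hω]))
    refine h1.congr ?_
    filter_upwards [Filter.eventually_all.2 hae] with ω hω
    simp [Finset.sum_apply, hω]
  -- The Chernoff parameter is ±aη, admissible because η ≤ 1. As aC ≤ 1/2, the quadratic term
  -- consumes at most half of the linear gain n a η².
  have hrate : n * (C * (a * η) ^ 2) ≤ n * (a / 2 * η ^ 2) := by
    have : C * (a * η) ^ 2 = (a * C) * (a * η ^ 2) := by ring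
    rw [this]
    have h2 : (a * C) * (a * η ^ 2) ≤ 1 / 2 * (a * η ^ 2) := by gcongr
    have h3 : 1 / 2 * (a * η ^ 2) = a / 2 * η ^ 2 := by ring
    rw [← h3]
    gcongr
  have haη : |a * η| ≤ a := by
    rw [abs_of_pos (by positivity)]; nlinarith
  have haη' : |-(a * η)| ≤ a := by rwa [abs_neg]
  have h1 : P.real {ω | n * η ≤ (∑ s, X s) ω} ≤ Real.exp (-(n * (a / 2) * η ^ 2)) := by
    refine (measure_ge_le_exp_mul_mgf (t := a * η) (n * η) (by positivity)
      (hsint _ haη)).trans ?_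
    calc _ ≤ Real.exp (-(a * η) * (n * η)) * Real.exp (n * (C * (a * η) ^ 2)) := by
          gcongr; exact hsum _ haη
      _ ≤ _ := by
          rw [← Real.exp_add]
          gcongr
          nlinarith
  have h2 : P.real {ω | (∑ s, X s) ω ≤ -(n * η)} ≤ Real.exp (-(n * (a / 2) * η ^ 2)) := by
    refine (measure_le_le_exp_mul_mgf (t := -(a * η)) (-(n * η)) (by
      rw [neg_nonpos]; positivity) (hsint _ haη')).trans ?_
    calc _ ≤ Real.exp (-(-(a * η)) * (-(n * η))) * Real.exp (n * (C * (-(a * η)) ^ 2)) := by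
          gcongr; exact hsum _ haη'
      _ ≤ _ := by
          rw [← Real.exp_add, neg_sq]
          gcongr
          nlinarith
  have hsub : {ω | n * η ≤ |∑ s, X s ω|}
      ⊆ {ω | n * η ≤ (∑ s, X s) ω} ∪ {ω | (∑ s, X s) ω ≤ -(n * η)} := by
    intro ω hω
    have hω' : (n : ℝ) * η ≤ |∑ s, X s ω| := hω
    rcases le_abs'.1 hω' with h | h
    · right; simpa using h
    · left; simpa using h
  calc _ ≤ P.real ({ω | n * η ≤ (∑ s, X s) ω} ∪ {ω | (∑ s, X s) ω ≤ -(n * η)}) :=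
        measureReal_mono hsub
    _ ≤ _ := measureReal_union_le _ _
    _ ≤ _ := by linarith

/-- Hoeffding's inequality for a two-sided deviation of variables with values in `[-1, 1]`. -/
theorem measureReal_abs_sum_sub_ge_le [IsProbabilityMeasure P] {n : ℕ} {X : Fin n → Ω → ℝ}
    (hind : iIndepFun X P) (hm : ∀ s, AEMeasurable (X s) P) (hb : ∀ s ω, |X s ω| ≤ 1) {m κ : ℝ}
    (hmean : ∀ s, ∫ ω, X s ω ∂P = m) (hκ : 0 < κ) (hκ1 : κ ≤ 1) :
    P.real {ω | n * κ ≤ |∑ s, X s ω - n * m|} ≤ 2 * Real.exp (-(n * (1 / 2) * κ ^ 2)) := by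
  -- The variance proxy is the square of half the length of [-1, 1], that is 1. The Chernoff bound
  -- then applies with a = 1 and C = 1/2.
  have hsg : ∀ s, HasSubgaussianMGF (fun ω => X s ω - m) 1 P := by
    intro s
    have := hasSubgaussianMGF_of_mem_Icc (μ := P) (hm s) (a := -1) (b := 1)
      (Filter.Eventually.of_forall fun ω => abs_le.1 (hb s ω))
    rw [hmean s] at this
    convert! this
    apply NNReal.eq
    simp
    norm_num
  have := measureReal_abs_sum_ge_le_of_mgf_le (P := P) (X := fun s ω => X s ω - m) (a := 1)
    (C := 1 / 2) (η := κ)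
    (hind.comp (fun _ y => y - m) (fun _ => by fun_prop)) (fun s => (hm s).sub_const m)
    one_pos (by norm_num) hκ hκ1 (fun s t _ => (hsg s).integrable_exp_mul t)
    (fun s t _ => by
      refine ((hsg s).mgf_le t).trans (le_of_eq ?_)
      congr 1
      push_cast
      ring)
  simpa [Finset.sum_sub_distrib] using this

/-- The product of a sub-Gaussian variable with an independent variable `z` with a square
exponential moment has a moment generating function that is bounded by a Gaussian one near zero. -/
theorem mgf_mul_le_of_indepFun [IsProbabilityMeasure P] {z ν : Ω → ℝ} {σ2 : ℝ≥0} {b D : ℝ}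
    (hz : AEMeasurable z P)
    (hν : HasSubgaussianMGF ν σ2 P) (hind : IndepFun z ν P) (hb : 0 < b)
    (hzint : Integrable (fun ω => Real.exp (b * z ω ^ 2)) P)
    (hzD : ∫ ω, Real.exp (b * z ω ^ 2) ∂P ≤ D) {t : ℝ} (ht : σ2 * t ^ 2 / 2 ≤ b) :
    Integrable (fun ω => Real.exp (t * (ν ω * z ω))) P ∧
      mgf (fun ω => ν ω * z ω) P t ≤ Real.exp (σ2 * (D - 1) / (2 * b) * t ^ 2) := by
  have hνm := hν.aemeasurable
  set r : ℝ := σ2 * t ^ 2 / 2 / b with hr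
  have hr0 : 0 ≤ r := by positivity
  have hr1 : r ≤ 1 := by rw [hr, div_le_one hb]; exact ht
  -- Given z = y, the sub-Gaussian bound is exp(r b y²) with r ≤ 1. Convexity of exp between 0 and b
  -- y² extracts the factor r, which is quadratic in t; after integration, 1 + r (D - 1) ≤ exp(r (D
  -- - 1)).
  have hpt : ∀ y : ℝ, Real.exp (σ2 * (t * y) ^ 2 / 2) ≤ 1 - r + r * Real.exp (b * y ^ 2) := by
    intro y
    have h1 := convexOn_exp.2 (Set.mem_univ 0) (Set.mem_univ (b * y ^ 2))
      (by linarith : 0 ≤ 1 - r) hr0 (by ring)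
    simp only [smul_eq_mul, mul_zero, zero_add, Real.exp_zero, mul_one] at h1
    refine le_trans (le_of_eq ?_) h1
    congr 1
    rw [hr]; field_simp
  -- With lower integrals Tonelli needs no prior integrability, and the finite bound supplies
  -- integrability as well.
  have hlint : ∫⁻ ω, ENNReal.ofReal (Real.exp (t * (ν ω * z ω))) ∂P
      ≤ ENNReal.ofReal (1 - r + r * D) := by
    have hmap := (indepFun_iff_map_prod_eq_prod_map_map hz hνm).1 hind
    have hmeas : Measurable fun p : ℝ × ℝ => ENNReal.ofReal (Real.exp (t * (p.2 * p.1))) := by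
      fun_prop
    have e1 : ∫⁻ ω, ENNReal.ofReal (Real.exp (t * (ν ω * z ω))) ∂P
        = ∫⁻ p, ENNReal.ofReal (Real.exp (t * (p.2 * p.1))) ∂(P.map fun ω => (z ω, ν ω)) := by
      rw [lintegral_map' hmeas.aemeasurable (hz.prodMk hνm)]
    have : IsProbabilityMeasure (P.map ν) := Measure.isProbabilityMeasure_map hνm
    rw [e1, hmap, lintegral_prod _ hmeas.aemeasurable]
    calc ∫⁻ y, ∫⁻ x, ENNReal.ofReal (Real.exp (t * (x * y))) ∂(P.map ν) ∂(P.map z)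
        ≤ ∫⁻ y, ENNReal.ofReal (1 - r + r * Real.exp (b * y ^ 2)) ∂(P.map z) := by
          refine lintegral_mono fun y => ?_
          have hi := hν.integrable_exp_mul (t * y)
          have e2 : ∫⁻ x, ENNReal.ofReal (Real.exp (t * (x * y))) ∂(P.map ν)
              = ENNReal.ofReal (mgf ν P (t * y)) := by
            rw [lintegral_map' (by fun_prop) hνm, mgf,
              ofReal_integral_eq_lintegral_ofReal hi
                (Filter.Eventually.of_forall fun _ => (Real.exp_pos _).le)]
            refine lintegral_congr fun ω => ?_
            congr 2
            ring
          rw [e2]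
          exact ENNReal.ofReal_le_ofReal ((hν.mgf_le _).trans (hpt y))
      _ = ∫⁻ ω, ENNReal.ofReal (1 - r + r * Real.exp (b * z ω ^ 2)) ∂P := by
          rw [lintegral_map' (by fun_prop) hz]
      _ = ENNReal.ofReal (∫ ω, (1 - r + r * Real.exp (b * z ω ^ 2)) ∂P) := by
          rw [ofReal_integral_eq_lintegral_ofReal]
          · exact (integrable_const _).add (hzint.const_mul r)
          · refine Filter.Eventually.of_forall fun ω => ?_
            have : 0 ≤ 1 - r := by linarith
            positivity
      _ ≤ ENNReal.ofReal (1 - r + r * D) := by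
          refine ENNReal.ofReal_le_ofReal ?_
          rw [integral_add (integrable_const _) (hzint.const_mul r), integral_const_mul]
          simp only [integral_const, probReal_univ, smul_eq_mul, one_mul]
          gcongr
  have hint : Integrable (fun ω => Real.exp (t * (ν ω * z ω))) P := by
    refine ⟨(Real.measurable_exp.comp_aemeasurable
      ((hνm.mul hz).const_mul t)).aestronglyMeasurable, ?_⟩
    rw [hasFiniteIntegral_iff_ofReal (Filter.Eventually.of_forall fun _ => (Real.exp_pos _).le)]
    exact hlint.trans_lt ENNReal.ofReal_lt_top
  refine ⟨hint, ?_⟩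
  have hD1 : 1 ≤ D := by
    refine le_trans ?_ hzD
    calc (1 : ℝ) = ∫ _, (1 : ℝ) ∂P := by simp
      _ ≤ _ := integral_mono (integrable_const _) hzint fun ω => by
          rw [Real.one_le_exp_iff]; positivity
  have h1 : mgf (fun ω => ν ω * z ω) P t ≤ 1 - r + r * D := by
    have hnn : 0 ≤ 1 - r + r * D := by nlinarith
    rw [← ENNReal.ofReal_le_ofReal_iff hnn, mgf,
      ofReal_integral_eq_lintegral_ofReal hint
        (Filter.Eventually.of_forall fun _ => (Real.exp_pos _).le)]
    exact hlint
  refine h1.trans ?_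
  have h2 := Real.add_one_le_exp (r * (D - 1))
  calc 1 - r + r * D = r * (D - 1) + 1 := by ring
    _ ≤ Real.exp (r * (D - 1)) := h2
    _ = _ := by congr 1; rw [hr]; field_simp

end Concentration

/-! ### Lower bounds for empirical Gram matrices. -/

section Gram

variable {Y ι : Type*} [MeasurableSpace Y] [Fintype ι]

/-- Entry of the normalized rank-one matrix `z zᵀ / ‖z‖²`. -/
noncomputable def normalizedGram (z : ι → ℝ) (p q : ι) : ℝ := z p * z q / ∑ k, z k ^ 2

/-- Boundedness is the purpose of the normalization: the entries of z zᵀ are unbounded, whereas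
these ones are covered by Hoeffding's inequality. -/
theorem abs_normalizedGram_le_one (z : ι → ℝ) (p q : ι) : |normalizedGram z p q| ≤ 1 := by
  have hnn : 0 ≤ ∑ k, z k ^ 2 := Finset.sum_nonneg fun _ _ => sq_nonneg _
  rw [normalizedGram, abs_div, abs_of_nonneg hnn]
  refine div_le_one_of_le₀ ?_ hnn
  have hp : z p ^ 2 ≤ ∑ k, z k ^ 2 :=
    Finset.single_le_sum (f := fun k => z k ^ 2) (fun _ _ => sq_nonneg _) (Finset.mem_univ p)
  have hq : z q ^ 2 ≤ ∑ k, z k ^ 2 :=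
    Finset.single_le_sum (f := fun k => z k ^ 2) (fun _ _ => sq_nonneg _) (Finset.mem_univ q)
  rw [abs_mul]
  nlinarith [sq_nonneg (|z p| - |z q|), sq_abs (z p), sq_abs (z q)]

theorem sum_normalizedGram (z v : ι → ℝ) :
    ∑ p, ∑ q, v p * v q * normalizedGram z p q = (∑ q, v q * z q) ^ 2 / ∑ k, z k ^ 2 := by
  rw [sq, Finset.sum_mul_sum, Finset.sum_div]
  refine Finset.sum_congr rfl fun p _ => ?_
  rw [Finset.sum_div]
  refine Finset.sum_congr rfl fun q _ => ?_
  rw [normalizedGram]; ring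

theorem measurable_normalizedGram (p q : ι) :
    Measurable fun z : ι → ℝ => normalizedGram z p q := by
  unfold normalizedGram
  fun_prop

/-- A quadratic form that is positive away from zero is bounded below. -/
theorem exists_quadraticForm_ge [Nonempty ι] (m : ι → ι → ℝ)
    (h : ∀ v : ι → ℝ, v ≠ 0 → 0 < ∑ p, ∑ q, v p * v q * m p q) :
    ∃ c > 0, ∀ v : ι → ℝ, c * ∑ q, v q ^ 2 ≤ ∑ p, ∑ q, v p * v q * m p q := by
  set f : EuclideanSpace ℝ ι → ℝ := fun v => ∑ p, ∑ q, v p * v q * m p q with hf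
  have hcont : Continuous f := by fun_prop
  obtain ⟨v₀, hv₀, hmin⟩ := (isCompact_sphere (0 : EuclideanSpace ℝ ι) 1).exists_isMinOn
    (NormedSpace.sphere_nonempty.2 zero_le_one) hcont.continuousOn
  have hv₀' : ‖v₀‖ = 1 := by simpa using hv₀
  have hpos : 0 < f v₀ := by
    refine h v₀.ofLp fun h0 => ?_
    have : v₀ = 0 := by ext i; exact congrFun h0 i
    rw [this, norm_zero] at hv₀'
    exact zero_ne_one hv₀'
  refine ⟨f v₀, hpos, fun v => ?_⟩
  set w : EuclideanSpace ℝ ι := WithLp.toLp 2 v with hw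
  have hn : ∑ q, v q ^ 2 = ‖w‖ ^ 2 := by rw [EuclideanSpace.real_norm_sq_eq]
  rw [hn]
  change _ ≤ f w
  by_cases hw0 : w = 0
  · simp [hw0, hf]
  have hwpos : 0 < ‖w‖ := norm_pos_iff.2 hw0
  have h1 : f v₀ ≤ f (‖w‖⁻¹ • w) := hmin (by simp [norm_smul, hwpos.ne'])
  have h2 : f (‖w‖⁻¹ • w) = (‖w‖ ^ 2)⁻¹ * f w := by
    simp only [hf, PiLp.smul_apply, smul_eq_mul, Finset.mul_sum]
    refine Finset.sum_congr rfl fun p _ => Finset.sum_congr rfl fun q _ => ?_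
    field_simp
  rw [h2, ← div_eq_inv_mul, le_div_iff₀ (by positivity)] at h1
  exact h1

/-- If no nontrivial linear combination of the regressors vanishes almost surely, their mean
normalized Gram matrix is bounded below. -/
theorem exists_mean_normalizedGram_ge [Nonempty ι] (ρ : Measure Y) [IsProbabilityMeasure ρ]
    {z : Y → ι → ℝ}
    (hz : Measurable z) (hpos : ∀ y, 0 < ∑ k, z y k ^ 2)
    (hnd : ∀ v : ι → ℝ, (∀ᵐ y ∂ρ, ∑ q, v q * z y q = 0) → v = 0) :
    ∃ c > 0, ∀ v : ι → ℝ, c * ∑ q, v q ^ 2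
      ≤ ∑ p, ∑ q, v p * v q * ∫ y, normalizedGram (z y) p q ∂ρ := by
  have hint : ∀ p q, Integrable (fun y => normalizedGram (z y) p q) ρ := fun p q =>
    Integrable.of_bound ((measurable_normalizedGram p q).comp hz).aestronglyMeasurable 1
      (Filter.Eventually.of_forall fun y => abs_normalizedGram_le_one _ _ _)
  refine exists_quadraticForm_ge _ fun v hv => ?_
  have h1 : ∑ p, ∑ q, v p * v q * ∫ y, normalizedGram (z y) p q ∂ρ
      = ∫ y, (∑ q, v q * z y q) ^ 2 / ∑ k, z y k ^ 2 ∂ρ := by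
    simp_rw [← sum_normalizedGram]
    rw [integral_finsetSum _ fun p _ => integrable_finsetSum _ fun q _ => (hint p q).const_mul _]
    refine Finset.sum_congr rfl fun p _ => ?_
    rw [integral_finsetSum _ fun q _ => (hint p q).const_mul _]
    simp_rw [integral_const_mul]
  have hI : Integrable (fun y => (∑ q, v q * z y q) ^ 2 / ∑ k, z y k ^ 2) ρ := by
    simp_rw [← sum_normalizedGram]
    exact integrable_finsetSum _ fun p _ => integrable_finsetSum _ fun q _ =>
      (hint p q).const_mul _
  have hnn : 0 ≤ fun y => (∑ q, v q * z y q) ^ 2 / ∑ k, z y k ^ 2 :=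
    fun y => div_nonneg (sq_nonneg _) (hpos y).le
  rw [h1]
  refine lt_of_le_of_ne (integral_nonneg hnn) fun h0 => hv (hnd v ?_)
  have h2 := (integral_eq_zero_iff_of_nonneg hnn hI).1 h0.symm
  filter_upwards [h2] with y hy
  have hy' : (∑ q, v q * z y q) ^ 2 / ∑ k, z y k ^ 2 = 0 := hy
  rw [div_eq_zero_iff] at hy'
  rcases hy' with h | h
  · exact pow_eq_zero_iff (two_ne_zero) |>.1 h
  · exact absurd h (hpos y).ne'

/-- Lower bound for an empirical Gram matrix whose normalized version is close to `m`. -/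
theorem sum_sq_ge_of_normalizedGram_close {n : ℕ} {z : Fin n → ι → ℝ} {m : ι → ι → ℝ} {c κ : ℝ}
    (hpos : ∀ s, 1 ≤ ∑ k, z s k ^ 2)
    (hm : ∀ v : ι → ℝ, c * ∑ q, v q ^ 2 ≤ ∑ p, ∑ q, v p * v q * m p q)
    (hclose : ∀ p q, |∑ s, normalizedGram (z s) p q - n * m p q| ≤ n * κ) (v : ι → ℝ) :
    n * (c - κ * Fintype.card ι) * ∑ q, v q ^ 2 ≤ ∑ s, (∑ q, v q * z s q) ^ 2 := by
  -- Since ‖z‖ ≥ 1, the normalization can only decrease the quadratic form, which is harmless for a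
  -- lower bound.
  have h1 : ∑ p, ∑ q, v p * v q * ∑ s, normalizedGram (z s) p q
      ≤ ∑ s, (∑ q, v q * z s q) ^ 2 := by
    have e1 : ∑ p, ∑ q, v p * v q * ∑ s, normalizedGram (z s) p q
        = ∑ s, ∑ p, ∑ q, v p * v q * normalizedGram (z s) p q := by
      simp_rw [Finset.mul_sum]
      rw [Finset.sum_comm]
      refine (Finset.sum_congr rfl fun p _ => Finset.sum_comm).trans ?_
      rw [Finset.sum_comm]
      refine Finset.sum_congr rfl fun s _ => Finset.sum_comm
    rw [e1]
    refine Finset.sum_le_sum fun s _ => ?_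
    rw [sum_normalizedGram]
    exact div_le_self (sq_nonneg _) (hpos s)
  have h2 : ∀ p q, v p * v q * (n * m p q) - n * κ * (|v p| * |v q|)
      ≤ v p * v q * ∑ s, normalizedGram (z s) p q := by
    intro p q
    have h3 : |v p * v q * (∑ s, normalizedGram (z s) p q - n * m p q)|
        ≤ |v p| * |v q| * (n * κ) := by
      rw [abs_mul, abs_mul]
      exact mul_le_mul_of_nonneg_left (hclose p q) (by positivity)
    have := neg_le_of_abs_le h3
    linarith
  have hκ : ∀ p q : ι, 0 ≤ (n : ℝ) * κ := fun p q => (abs_nonneg _).trans (hclose p q)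
  have h4 : (n : ℝ) * κ * (∑ p, |v p|) ^ 2 ≤ n * κ * (Fintype.card ι * ∑ q, v q ^ 2) := by
    rcases isEmpty_or_nonempty ι with hι | ⟨⟨p⟩⟩
    · simp
    · refine mul_le_mul_of_nonneg_left ?_ (hκ p p)
      have := sq_sum_le_card_mul_sum_sq (s := (Finset.univ : Finset ι)) (f := fun p => |v p|)
      simpa using this
  calc n * (c - κ * Fintype.card ι) * ∑ q, v q ^ 2
      = n * (c * ∑ q, v q ^ 2) - n * κ * (Fintype.card ι * ∑ q, v q ^ 2) := by ring
    _ ≤ n * (∑ p, ∑ q, v p * v q * m p q) - n * κ * (∑ p, |v p|) ^ 2 := by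
        have := mul_le_mul_of_nonneg_left (hm v) (Nat.cast_nonneg (α := ℝ) n)
        linarith
    _ = ∑ p, ∑ q, (v p * v q * (n * m p q) - n * κ * (|v p| * |v q|)) := by
        rw [sq, Finset.sum_mul_sum, Finset.mul_sum, Finset.mul_sum, ← Finset.sum_sub_distrib]
        refine Finset.sum_congr rfl fun p _ => ?_
        rw [Finset.mul_sum, Finset.mul_sum, ← Finset.sum_sub_distrib]
        refine Finset.sum_congr rfl fun q _ => ?_
        ring
    _ ≤ ∑ p, ∑ q, v p * v q * ∑ s, normalizedGram (z s) p q :=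
        Finset.sum_le_sum fun p _ => Finset.sum_le_sum fun q _ => h2 p q
    _ ≤ _ := h1

end Gram

/-! ### Deterministic error bound for the least-squares estimate. -/

section Regression

variable {N nx nu : ℕ}

/-- The regressor `[x, 1]`. -/
def regressor (x : Fin nx → ℝ) : Fin nx ⊕ Unit → ℝ := Sum.elim x fun _ => 1

theorem one_le_sum_sq_regressor (x : Fin nx → ℝ) : 1 ≤ ∑ k, regressor x k ^ 2 := by
  simp only [regressor, Fintype.sum_sum_type, Sum.elim_inl, Sum.elim_inr]
  have : 0 ≤ ∑ k, x k ^ 2 := Finset.sum_nonneg fun _ _ => sq_nonneg _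
  simpa using this

/-- Error of a least-squares estimate in terms of the Gram matrix of the regressors and of their
correlation with the noise. -/
theorem IsRegression.policyError_le {n : ℕ} (hn : 0 < n) {pol' pol : AffinePolicy N nx nu} {t : ℕ}
    {i : Fin N} {x : Fin n → Fin nx → ℝ} {ν : Fin n → Fin nu → ℝ}
    (hreg : IsRegression x (fun s => -(pol.K t i *ᵥ x s) - pol.α t i + ν s)
      (pol'.K t i) (pol'.α t i)) {c η : ℝ} (hc : 0 < c)
    (hgram : ∀ v : Fin nx ⊕ Unit → ℝ,
      n * c * ∑ q, v q ^ 2 ≤ ∑ s, (∑ q, v q * regressor (x s) q) ^ 2)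
    (hcross : ∀ a q, |∑ s, ν s a * regressor (x s) q| ≤ n * η) :
    policyError pol' pol t i ≤ 2 * η * (nu * (nx + 1)) / c := by
  set W := policyDiff pol' pol t i with hW
  set e := policyError pol' pol t i with he
  have hn' : (0 : ℝ) < n := by exact_mod_cast hn
  -- The estimate is compared with the true policy, whose residual is exactly the noise; its own
  -- residual is W z + ν. Expanding the square leaves a quadratic form bounded by a cross term.
  have hbasic : ∑ s, ∑ a, (∑ q, W a q * regressor (x s) q + ν s a) ^ 2
      ≤ ∑ s, ∑ a, ν s a ^ 2 := by
    have h := hreg (pol.K t i) (pol.α t i)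
    simp only [EuclideanSpace.real_norm_sq_eq] at h
    convert h using 5 with s _ a _ s _ a _
    · simp only [hW, policyDiff, regressor, Fintype.sum_sum_type, Matrix.sub_apply,
        Matrix.fromCols_apply_inl, Matrix.fromCols_apply_inr, Matrix.replicateCol_apply,
        Sum.elim_inl, Sum.elim_inr, Pi.add_apply, Pi.sub_apply, Pi.neg_apply, Matrix.mulVec,
        dotProduct, sub_mul, Finset.sum_sub_distrib]
      simp
      ring
    · simp only [Pi.add_apply, Pi.sub_apply, Pi.neg_apply]
      ring
  have hquad : ∑ s, ∑ a, (∑ q, W a q * regressor (x s) q) ^ 2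
      ≤ -2 * ∑ a, ∑ q, W a q * ∑ s, ν s a * regressor (x s) q := by
    have e1 : ∑ s, ∑ a, (∑ q, W a q * regressor (x s) q + ν s a) ^ 2
        = ∑ s, ∑ a, (∑ q, W a q * regressor (x s) q) ^ 2
          + 2 * ∑ s, ∑ a, (∑ q, W a q * regressor (x s) q) * ν s a + ∑ s, ∑ a, ν s a ^ 2 := by
      simp only [add_sq, Finset.sum_add_distrib, mul_assoc, ← Finset.mul_sum]
    have e2 : ∑ s, ∑ a, (∑ q, W a q * regressor (x s) q) * ν s a
        = ∑ a, ∑ q, W a q * ∑ s, ν s a * regressor (x s) q := by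
      rw [Finset.sum_comm]
      refine Finset.sum_congr rfl fun a _ => ?_
      simp_rw [Finset.sum_mul, Finset.mul_sum]
      rw [Finset.sum_comm]
      refine Finset.sum_congr rfl fun q _ => Finset.sum_congr rfl fun s _ => ?_
      ring
    rw [e1, e2] at hbasic
    linarith
  have hlow : n * c * e ^ 2 ≤ ∑ s, ∑ a, (∑ q, W a q * regressor (x s) q) ^ 2 := by
    rw [he, policyError_sq, Finset.sum_comm (s := (Finset.univ : Finset (Fin n))), Finset.mul_sum]
    exact Finset.sum_le_sum fun a _ => hgram (W a)
  have hup : -2 * ∑ a, ∑ q, W a q * ∑ s, ν s a * regressor (x s) q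
      ≤ 2 * (nu * (nx + 1) * (e * (n * η))) := by
    have : -(∑ a, ∑ q, W a q * ∑ s, ν s a * regressor (x s) q)
        ≤ ∑ _a : Fin nu, ∑ _q : Fin nx ⊕ Unit, e * (n * η) := by
      rw [← Finset.sum_neg_distrib]
      refine Finset.sum_le_sum fun a _ => ?_
      rw [← Finset.sum_neg_distrib]
      refine Finset.sum_le_sum fun q _ => ?_
      refine (neg_le_abs _).trans ?_
      rw [abs_mul]
      exact mul_le_mul (abs_policyDiff_le _ _ _ _ _ _) (hcross a q) (abs_nonneg _)
        (policyError_nonneg _ _ _ _)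
    simp only [Finset.sum_const, Finset.card_univ, Fintype.card_fin, Fintype.card_sum,
      Fintype.card_unit, nsmul_eq_mul] at this
    push_cast at this
    linarith
  have hmain : n * (c * e) * e ≤ n * (2 * η * (nu * (nx + 1))) * e := by
    have := hlow.trans (hquad.trans hup)
    linarith
  have he0 : 0 ≤ e := policyError_nonneg _ _ _ _
  -- For e = 0 division by e is impossible and the right side must be shown nonnegative: either ν
  -- has a coordinate, and the correlation bound forces η ≥ 0, or nu = 0.
  rcases he0.eq_or_lt with h0 | h0
  · rw [← h0]
    rcases isEmpty_or_nonempty (Fin nu) with hnu | ⟨⟨a⟩⟩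
    · have : nu = 0 := by rw [← Fintype.card_fin nu]; exact Fintype.card_eq_zero_iff.2 hnu
      simp [this]
    · have h1 := (abs_nonneg _).trans (hcross a (Sum.inr ()))
      have h2 : 0 ≤ η := nonneg_of_mul_nonneg_right h1 hn'
      positivity
  · rw [le_div_iff₀ hc]
    have h1 := le_of_mul_le_mul_right hmain h0
    have h2 := le_of_mul_le_mul_left h1 hn'
    linarith

end Regression

/-! ### Tails and nondegeneracy of the state distribution. -/

section StateLaw

open scoped InnerProductSpace

variable {N nx nu : ℕ} {T : ℕ} (dyn : LinearDynamics N nx nu) (pol : AffinePolicy N nx nu)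

/-- Initial state and system noise of one demonstration. -/
abbrev NoiseSpace (T nx : ℕ) : Type :=
  EuclideanSpace ℝ (Fin nx) × (Fin T → EuclideanSpace ℝ (Fin nx))

/-- Law of the initial state and the system noise of one demonstration. -/
noncomputable def noiseLaw (T : ℕ) (μ₀ : EuclideanSpace ℝ (Fin nx)) (χ₀ : Matrix (Fin nx) (Fin nx) ℝ)
    (Sig : ℕ → Matrix (Fin nx) (Fin nx) ℝ) : Measure (NoiseSpace T nx) :=
  (multivariateGaussian μ₀ χ₀).prod (Measure.pi fun t : Fin T => multivariateGaussian 0 (Sig t))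

/-- The state as a function of the initial state and the system noise before the horizon. -/
noncomputable def stateFun (t : ℕ) (y : NoiseSpace T nx) : Fin nx → ℝ :=
  stateTraj dyn pol y.1.ofLp (fun r => if h : r < T then (y.2 ⟨r, h⟩).ofLp else 0) t

theorem stateTraj_succ (x₀ : Fin nx → ℝ) (w : ℕ → Fin nx → ℝ) (t : ℕ) :
    stateTraj dyn pol x₀ w (t + 1)
      = closedLoop dyn pol t *ᵥ stateTraj dyn pol x₀ w t - drift dyn pol t + w t := by
  rw [stateTraj, closedLoop, drift, Matrix.sub_mulVec, Matrix.sum_mulVec]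
  simp only [Matrix.mulVec_sub, Matrix.mulVec_neg, Matrix.mulVec_mulVec, Finset.sum_sub_distrib,
    Finset.sum_neg_distrib]
  abel

theorem stateTraj_congr {x₀ : Fin nx → ℝ} {w w' : ℕ → Fin nx → ℝ} {t : ℕ}
    (h : ∀ r < t, w r = w' r) : stateTraj dyn pol x₀ w t = stateTraj dyn pol x₀ w' t := by
  induction t with
  | zero => rfl
  | succ t ih =>
    rw [stateTraj_succ, stateTraj_succ, ih fun r hr => h r (by omega), h t (by omega)]

theorem demoState_eq_stateFun {Ω : Type*} {n : ℕ} (x₀ : Fin n → Ω → EuclideanSpace ℝ (Fin nx))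
    (w : Fin n → ℕ → Ω → EuclideanSpace ℝ (Fin nx)) (ω : Ω) {t : ℕ} (ht : t ≤ T) (s : Fin n) :
    demoState dyn pol x₀ w ω t s
      = stateFun dyn pol t ((x₀ s ω, fun r : Fin T => w s r ω) : NoiseSpace T nx) := by
  refine stateTraj_congr dyn pol fun r hr => ?_
  rw [dif_pos (by omega)]

theorem continuous_stateFun (t : ℕ) :
    Continuous (stateFun dyn pol t : NoiseSpace T nx → Fin nx → ℝ) := by
  induction t with
  | zero => exact (PiLp.continuous_ofLp 2 _).comp continuous_fst
  | succ t ih =>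
    have h : (stateFun dyn pol (t + 1) : NoiseSpace T nx → Fin nx → ℝ) = fun y =>
        closedLoop dyn pol t *ᵥ stateFun dyn pol t y - drift dyn pol t
          + (if h : t < T then (y.2 ⟨t, h⟩).ofLp else 0) := by
      ext1 y; exact stateTraj_succ _ _ _ _ _
    rw [h]
    refine ((continuous_const.matrix_mulVec ih).sub continuous_const).add ?_
    split_ifs with hT
    · exact (PiLp.continuous_ofLp 2 _).comp ((continuous_apply _).comp continuous_snd)
    · exact continuous_const

theorem exists_norm_stateFun_le (t : ℕ) :
    ∃ C, 0 ≤ C ∧ ∀ y : NoiseSpace T nx, ‖stateFun dyn pol t y‖ ≤ C * (1 + ‖y‖) := by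
  have hof : ∀ x : EuclideanSpace ℝ (Fin nx), ‖x.ofLp‖ ≤ ‖x‖ := by
    intro x
    rw [pi_norm_le_iff_of_nonneg (norm_nonneg _)]
    exact fun i => PiLp.norm_apply_le x i
  induction t with
  | zero =>
    refine ⟨1, zero_le_one, fun y => ?_⟩
    have h1 : ‖y.1.ofLp‖ ≤ ‖y‖ := (hof _).trans (norm_fst_le y)
    change ‖y.1.ofLp‖ ≤ _
    linarith
  | succ t ih =>
    obtain ⟨C, hC, hCb⟩ := ih
    set L := LinearMap.toContinuousLinearMap (closedLoop dyn pol t).mulVecLin with hL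
    refine ⟨‖L‖ * C + ‖drift dyn pol t‖ + 1, by positivity, fun y => ?_⟩
    have h : stateFun dyn pol (t + 1) y = L (stateFun dyn pol t y) - drift dyn pol t
          + (if h : t < T then (y.2 ⟨t, h⟩).ofLp else 0) := stateTraj_succ _ _ _ _ _
    have h1 : ‖L (stateFun dyn pol t y)‖ ≤ ‖L‖ * (C * (1 + ‖y‖)) := L.le_opNorm_of_le (hCb y)
    have h2 : ‖(if h : t < T then (y.2 ⟨t, h⟩).ofLp else 0 : Fin nx → ℝ)‖ ≤ ‖y‖ := by
      split_ifs with hT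
      · exact (hof _).trans ((norm_le_pi_norm y.2 _).trans (norm_snd_le y))
      · simp
    rw [h]
    refine (norm_add_le _ _).trans ?_
    have h3 := norm_sub_le (L (stateFun dyn pol t y)) (drift dyn pol t)
    nlinarith [norm_nonneg y, norm_nonneg (drift dyn pol t)]

/-- The state is an affine function of the initial state with an invertible linear part. -/
theorem exists_stateTraj_eq_affine (hF : ∀ t < T, IsUnit (closedLoop dyn pol t)) {t : ℕ}
    (ht : t ≤ T) :
    ∃ Φ : Matrix (Fin nx) (Fin nx) ℝ, IsUnit Φ ∧ ∀ w : ℕ → Fin nx → ℝ, ∃ r : Fin nx → ℝ,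
      ∀ x₀ : Fin nx → ℝ, stateTraj dyn pol x₀ w t = Φ *ᵥ x₀ + r := by
  induction t with
  | zero => exact ⟨1, isUnit_one, fun w => ⟨0, fun x₀ => by simp [stateTraj]⟩⟩
  | succ t ih =>
    obtain ⟨Φ, hΦ, h⟩ := ih (by omega)
    refine ⟨closedLoop dyn pol t * Φ, (hF t (by omega)).mul hΦ, fun w => ?_⟩
    obtain ⟨r, hr⟩ := h w
    refine ⟨closedLoop dyn pol t *ᵥ r - drift dyn pol t + w t, fun x₀ => ?_⟩
    rw [stateTraj_succ, hr, Matrix.mulVec_add, Matrix.mulVec_mulVec]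
    abel

variable {dyn pol} {μ₀ : EuclideanSpace ℝ (Fin nx)} {χ₀ : Matrix (Fin nx) (Fin nx) ℝ}
  {Sig : ℕ → Matrix (Fin nx) (Fin nx) ℝ}

instance : IsProbabilityMeasure (noiseLaw T μ₀ χ₀ Sig) := by
  unfold noiseLaw; infer_instance

theorem isGaussian_pi {ι : Type*} [Fintype ι] {E : ι → Type*} [∀ i, NormedAddCommGroup (E i)]
    [∀ i, NormedSpace ℝ (E i)] [∀ i, MeasurableSpace (E i)] [∀ i, BorelSpace (E i)]
    [∀ i, CompleteSpace (E i)] [∀ i, SecondCountableTopology (E i)]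
    (μ : ∀ i, Measure (E i)) [∀ i, IsGaussian (μ i)] : IsGaussian (Measure.pi μ) := by
  have hlaw : ∀ i, HasLaw (fun y : ∀ i, E i => y i) (μ i) (Measure.pi μ) := fun i =>
    ⟨(measurable_pi_apply i).aemeasurable, (measurePreserving_eval μ i).map_eq⟩
  have hind : iIndepFun (fun i (y : ∀ i, E i) => y i) (Measure.pi μ) :=
    (iIndepFun_iff_hasLaw_pi_pi hlaw).2 ⟨aemeasurable_id, Measure.map_id⟩
  have := (hind.hasGaussianLaw fun i => (hlaw i).hasGaussianLaw).isGaussian_map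
  simpa using this

instance : IsGaussian (noiseLaw T μ₀ χ₀ Sig) := by
  have := isGaussian_pi fun t : Fin T => multivariateGaussian (0 : EuclideanSpace ℝ (Fin nx)) (Sig t)
  unfold noiseLaw
  infer_instance

/-- Fernique's theorem for the joint Gaussian law of initial state and noise, transferred through
the linear growth of the state. The last regressor is the constant 1, which the additive 1 in the
growth bound covers. -/
theorem exists_integrable_exp_sq_regressor (t : ℕ) :
    ∃ b > 0, ∀ q, Integrable (fun y => Real.exp (b * regressor (stateFun dyn pol t y) q ^ 2))
      (noiseLaw T μ₀ χ₀ Sig) := by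
  obtain ⟨b, hb, hint⟩ := IsGaussian.exists_integrable_exp_sq (noiseLaw T μ₀ χ₀ Sig)
  obtain ⟨C, hC, hCb⟩ := exists_norm_stateFun_le (T := T) dyn pol t
  refine ⟨b / (2 * (C + 1) ^ 2), by positivity, fun q => ?_⟩
  have hmeas : Measurable fun y : NoiseSpace T nx => regressor (stateFun dyn pol t y) q := by
    rcases q with q | q
    · exact ((continuous_apply q).comp (continuous_stateFun dyn pol t)).measurable
    · exact measurable_const
  refine (hint.const_mul (Real.exp b)).mono'
    (Real.measurable_exp.comp ((hmeas.pow_const 2).const_mul _)).aestronglyMeasurable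
    (Filter.Eventually.of_forall fun y => ?_)
  have hz : |regressor (stateFun dyn pol t y) q| ≤ (C + 1) * (1 + ‖y‖) := by
    rcases q with q | q
    · have h1 : |stateFun dyn pol t y q| ≤ C * (1 + ‖y‖) :=
        (norm_le_pi_norm (stateFun dyn pol t y) q).trans (hCb y)
      change |stateFun dyn pol t y q| ≤ _
      nlinarith [norm_nonneg y]
    · change |(1 : ℝ)| ≤ _
      rw [abs_one]
      nlinarith [norm_nonneg y]
  have hsq : regressor (stateFun dyn pol t y) q ^ 2 ≤ (2 * (C + 1) ^ 2) * (1 + ‖y‖ ^ 2) := by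
    have h1 := sq_le_sq' (by linarith [neg_abs_le (regressor (stateFun dyn pol t y) q)])
      ((le_abs_self _).trans hz)
    have h2 : (1 + ‖y‖) ^ 2 ≤ 2 * (1 + ‖y‖ ^ 2) := by nlinarith [sq_nonneg (1 - ‖y‖)]
    nlinarith [sq_nonneg (C + 1)]
  rw [Real.norm_of_nonneg (Real.exp_pos _).le, ← Real.exp_add]
  refine Real.exp_le_exp.2 ?_
  rw [div_mul_eq_mul_div, div_le_iff₀ (by positivity)]
  nlinarith

/-- The variance of ⟨u, x⟩ is uᵀ χ₀ u, which is positive unless u = 0, whereas a constant has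
variance zero. -/
theorem eq_zero_of_ae_dotProduct_eq_const (hχ : χ₀.PosDef) {u : Fin nx → ℝ} {k : ℝ}
    (h : ∀ᵐ x ∂(multivariateGaussian μ₀ χ₀), u ⬝ᵥ x.ofLp = k) : u = 0 := by
  have hvar : Var[fun x => ⟪WithLp.toLp 2 u, x⟫_ℝ; multivariateGaussian μ₀ χ₀] = 0 := by
    have h1 : (fun x : EuclideanSpace ℝ (Fin nx) => ⟪WithLp.toLp 2 u, x⟫_ℝ)
        =ᵐ[multivariateGaussian μ₀ χ₀] fun _ => k := by
      filter_upwards [h] with x hx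
      rw [← hx, EuclideanSpace.inner_eq_star_dotProduct, star_trivial, dotProduct_comm]
    rw [variance_congr h1]; simp [variance, evariance]
  rw [← covarianceBilin_self IsGaussian.memLp_two_id,
    covarianceBilin_multivariateGaussian hχ.posSemidef] at hvar
  by_contra hu
  have := hχ.dotProduct_mulVec_pos hu
  rw [star_trivial] at this
  exact this.ne' hvar

/-- No nontrivial affine function of the state vanishes almost surely. -/
theorem eq_zero_of_ae_sum_regressor_eq_zero (hF : ∀ t < T, IsUnit (closedLoop dyn pol t))
    (hχ : χ₀.PosDef) {t : ℕ} (ht : t ≤ T) (v : Fin nx ⊕ Unit → ℝ)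
    (h : ∀ᵐ y ∂(noiseLaw T μ₀ χ₀ Sig), ∑ q, v q * regressor (stateFun dyn pol t y) q = 0) :
    v = 0 := by
  obtain ⟨Φ, hΦ, haff⟩ := exists_stateTraj_eq_affine dyn pol hF ht
  have hform : ∀ y : NoiseSpace T nx, ∑ q, v q * regressor (stateFun dyn pol t y) q
      = (fun a => v (Sum.inl a)) ⬝ᵥ stateFun dyn pol t y + v (Sum.inr ()) := by
    intro y
    simp [regressor, Fintype.sum_sum_type, dotProduct]
  have hcont : Continuous fun y : NoiseSpace T nx =>
      (fun a => v (Sum.inl a)) ⬝ᵥ stateFun dyn pol t y + v (Sum.inr ()) :=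
    (continuous_const.dotProduct (continuous_stateFun dyn pol t)).add continuous_const
  simp only [hform] at h
  have hvx : (fun a => v (Sum.inl a)) = 0 := by
    have h1 := Measure.ae_ae_of_ae_prod h
    -- Exchanging the order of the quantifiers freezes a noise path and leaves the initial state
    -- random. All randomness used is that of the initial state, so degenerate Σ_t do no harm.
    replace h1 := (Measure.ae_ae_comm
      (p := fun (x : EuclideanSpace ℝ (Fin nx)) (w : Fin T → EuclideanSpace ℝ (Fin nx)) =>
        (fun a => v (Sum.inl a)) ⬝ᵥ stateFun dyn pol t (x, w) + v (Sum.inr ()) = 0)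
      (measurableSet_eq_fun hcont.measurable measurable_const)).1 h1
    obtain ⟨w, hw⟩ := h1.exists
    obtain ⟨r, hr⟩ := haff (fun k => if h : k < T then (w ⟨k, h⟩).ofLp else 0)
    have h2 : (fun a => v (Sum.inl a)) ᵥ* Φ = 0 := by
      refine eq_zero_of_ae_dotProduct_eq_const (μ₀ := μ₀) hχ
        (k := -((fun a => v (Sum.inl a)) ⬝ᵥ r) - v (Sum.inr ())) ?_
      filter_upwards [hw] with x hx
      have h3 : stateFun dyn pol t ((x, w) : NoiseSpace T nx) = Φ *ᵥ x.ofLp + r := hr _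
      rw [h3, dotProduct_add, Matrix.dotProduct_mulVec] at hx
      linarith
    have h4 := Matrix.vecMul_injective_of_isUnit hΦ
    exact h4 (by simpa using h2)
  have hv1 : v (Sum.inr ()) = 0 := by
    obtain ⟨y, hy⟩ := h.exists
    rw [hvx, zero_dotProduct, zero_add] at hy
    exact hy
  ext q
  rcases q with a | ⟨⟩
  · exact congrFun hvx a
  · exact hv1

end StateLaw

/-! ### Tail bounds and sample size for the policy estimates. -/

section Estimation

universe u

variable {N nx nu : ℕ} {T : ℕ} {dyn : LinearDynamics N nx nu} {pol : AffinePolicy N nx nu}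
  {μ₀ : EuclideanSpace ℝ (Fin nx)} {χ₀ : Matrix (Fin nx) (Fin nx) ℝ}
  {Sig : ℕ → Matrix (Fin nx) (Fin nx) ℝ} {σ2 : ℝ≥0}

theorem measurable_regressor_stateFun (t : ℕ) :
    Measurable fun y : NoiseSpace T nx => regressor (stateFun dyn pol t y) := by
  rw [measurable_pi_iff]
  rintro (q | q)
  · exact ((continuous_apply q).comp (continuous_stateFun dyn pol t)).measurable
  · exact measurable_const

section Demonstrations

variable {Ω : Type u} [MeasurableSpace Ω] {P : Measure Ω} [IsProbabilityMeasure P] {n : ℕ}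
  {x₀ : Fin n → Ω → EuclideanSpace ℝ (Fin nx)}
  {w : Fin n → ℕ → Ω → EuclideanSpace ℝ (Fin nx)}
  {ν : Fin n → ℕ → Fin N → Ω → Fin nu → ℝ}

namespace DemonstrationNoise

theorem hasLaw_noise (h : DemonstrationNoise P T n μ₀ χ₀ Sig σ2 x₀ w ν) (s : Fin n) :
    HasLaw (fun ω => ((x₀ s ω, fun r : Fin T => w s r ω) : NoiseSpace T nx))
      (noiseLaw T μ₀ χ₀ Sig) P :=
  (h.indep_init s).hasLaw_prod (h.law_init s)
    ((h.indep_noise s).hasLaw_pi fun r => h.law_noise s r r.2)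

/-- Deviation of the normalized empirical Gram matrix of the regressors from its mean. -/
theorem measureReal_gram_deviation_le (h : DemonstrationNoise P T n μ₀ χ₀ Sig σ2 x₀ w ν) {t : ℕ}
    (ht : t ≤ T) (p q : Fin nx ⊕ Unit) {κ : ℝ} (hκ : 0 < κ) (hκ1 : κ ≤ 1) :
    P.real {ω | n * κ ≤ |∑ s, normalizedGram (regressor (demoState dyn pol x₀ w ω t s)) p q
        - n * ∫ y, normalizedGram (regressor (stateFun dyn pol t y)) p q
          ∂(noiseLaw T μ₀ χ₀ Sig)|}
      ≤ 2 * Real.exp (-(n * (1 / 2) * κ ^ 2)) := by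
  have hG : Measurable fun y : NoiseSpace T nx =>
      normalizedGram (regressor (stateFun dyn pol t y)) p q :=
    (measurable_normalizedGram p q).comp (measurable_regressor_stateFun t)
  have hcomp : ∀ s, (fun ω => normalizedGram (regressor (demoState dyn pol x₀ w ω t s)) p q)
      = fun ω => normalizedGram (regressor (stateFun dyn pol t
        ((x₀ s ω, fun r : Fin T => w s r ω) : NoiseSpace T nx))) p q := by
    intro s; ext ω; rw [demoState_eq_stateFun dyn pol x₀ w ω ht s]
  refine measureReal_abs_sum_sub_ge_le
    (X := fun s ω => normalizedGram (regressor (demoState dyn pol x₀ w ω t s)) p q)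
    ?_ (fun s => ?_) (fun s ω => abs_normalizedGram_le_one _ _ _) (fun s => ?_) hκ hκ1
  · rw [funext hcomp]
    exact h.indep_samples.comp (fun _ d => normalizedGram (regressor (stateFun dyn pol t
      ((d.1, d.2.1) : NoiseSpace T nx))) p q)
      (fun _ => hG.comp (measurable_fst.prodMk (measurable_fst.comp measurable_snd)))
  · rw [hcomp]
    exact hG.comp_aemeasurable (h.hasLaw_noise s).aemeasurable
  · rw [hcomp]
    exact (h.hasLaw_noise s).integral_comp hG.aestronglyMeasurable

/-- Correlation of the observation noise with the regressors. -/
theorem measureReal_cross_ge_le (h : DemonstrationNoise P T n μ₀ χ₀ Sig σ2 x₀ w ν) {t : ℕ}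
    (ht : t < T) (i : Fin N) (k : Fin nu) (q : Fin nx ⊕ Unit) {a b D η : ℝ} (hb : 0 < b)
    (hint : Integrable (fun y => Real.exp (b * regressor (stateFun dyn pol t y) q ^ 2))
      (noiseLaw T μ₀ χ₀ Sig))
    (hD : ∫ y, Real.exp (b * regressor (stateFun dyn pol t y) q ^ 2) ∂(noiseLaw T μ₀ χ₀ Sig) ≤ D)
    (ha : 0 < a) (hab : σ2 * a ^ 2 / 2 ≤ b) (haD : a * (σ2 * (D - 1) / (2 * b)) ≤ 1 / 2)
    (hη : 0 < η) (hη1 : η ≤ 1) :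
    P.real {ω | n * η ≤ |∑ s, ν s t i ω k * regressor (demoState dyn pol x₀ w ω t s) q|}
      ≤ 2 * Real.exp (-(n * (a / 2) * η ^ 2)) := by
  have hz : Measurable fun y : NoiseSpace T nx => regressor (stateFun dyn pol t y) q :=
    (measurable_pi_apply q).comp (measurable_regressor_stateFun t)
  have hcomp : ∀ s, (fun ω => regressor (demoState dyn pol x₀ w ω t s) q)
      = fun ω => regressor (stateFun dyn pol t
        ((x₀ s ω, fun r : Fin T => w s r ω) : NoiseSpace T nx)) q := by
    intro s; ext ω; rw [demoState_eq_stateFun dyn pol x₀ w ω ht.le s]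
  have hzm : ∀ s, AEMeasurable (fun ω => regressor (demoState dyn pol x₀ w ω t s) q) P := by
    intro s
    rw [hcomp]
    exact hz.comp_aemeasurable (h.hasLaw_noise s).aemeasurable
  have hexp : Measurable fun y : NoiseSpace T nx =>
      Real.exp (b * regressor (stateFun dyn pol t y) q ^ 2) :=
    Real.measurable_exp.comp ((hz.pow_const 2).const_mul b)
  have hmgf : ∀ s r, |r| ≤ a →
      Integrable (fun ω =>
        Real.exp (r * (ν s t i ω k * regressor (demoState dyn pol x₀ w ω t s) q))) P ∧
      mgf (fun ω => ν s t i ω k * regressor (demoState dyn pol x₀ w ω t s) q) P r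
        ≤ Real.exp (σ2 * (D - 1) / (2 * b) * r ^ 2) := by
    intro s r hr
    have hind : IndepFun (fun ω => regressor (demoState dyn pol x₀ w ω t s) q)
        (fun ω => ν s t i ω k) P := by
      rw [hcomp]
      exact ((h.indep_obs s).comp (φ := fun d => d ⟨t, ht⟩ i k)
        (ψ := fun y : NoiseSpace T nx => regressor (stateFun dyn pol t y) q)
        (by fun_prop) hz).symm
    have hlaw := h.hasLaw_noise s
    refine mgf_mul_le_of_indepFun (b := b) (hzm s) (h.subgaussian_obs s t ht i k) hind hb ?_ ?_ ?_
    · have : Integrable (fun y => Real.exp (b * regressor (stateFun dyn pol t y) q ^ 2))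
          (P.map fun ω => ((x₀ s ω, fun r : Fin T => w s r ω) : NoiseSpace T nx)) := by
        rw [hlaw.map_eq]; exact hint
      have h2 := this.comp_aemeasurable hlaw.aemeasurable
      refine h2.congr (Filter.Eventually.of_forall fun ω => ?_)
      simp only [Function.comp_apply]
      rw [demoState_eq_stateFun dyn pol x₀ w ω ht.le s]
    · refine le_trans (le_of_eq ?_) hD
      rw [← hlaw.integral_comp hexp.aestronglyMeasurable]
      refine integral_congr_ae (Filter.Eventually.of_forall fun ω => ?_)
      simp only [Function.comp_apply]
      rw [demoState_eq_stateFun dyn pol x₀ w ω ht.le s]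
    · refine le_trans ?_ hab
      have : r ^ 2 ≤ a ^ 2 := sq_le_sq' (by linarith [neg_abs_le r]) ((le_abs_self r).trans hr)
      gcongr
  refine measureReal_abs_sum_ge_le_of_mgf_le
    (X := fun s ω => ν s t i ω k * regressor (demoState dyn pol x₀ w ω t s) q)
    ?_ (fun s => ?_) ha haD hη hη1 (fun s r hr => (hmgf s r hr).1) (fun s r hr => (hmgf s r hr).2)
  · have hcomp' : (fun s ω => ν s t i ω k * regressor (demoState dyn pol x₀ w ω t s) q)
        = fun s ω => ν s t i ω k * regressor (stateFun dyn pol t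
          ((x₀ s ω, fun r : Fin T => w s r ω) : NoiseSpace T nx)) q := by
      ext s ω; rw [demoState_eq_stateFun dyn pol x₀ w ω ht.le s]
    rw [hcomp']
    refine h.indep_samples.comp (fun _ d => d.2.2 ⟨t, ht⟩ i k * regressor (stateFun dyn pol t
      ((d.1, d.2.1) : NoiseSpace T nx)) q) (fun _ => Measurable.mul (by fun_prop) ?_)
    exact hz.comp (measurable_fst.prodMk (measurable_fst.comp measurable_snd))
  · exact (h.subgaussian_obs s t ht i k).aemeasurable.mul (hzm s)

end DemonstrationNoise

end Demonstrations

theorem measureReal_le_card_mul_of_subset_iUnion {Ω J : Type*} [MeasurableSpace Ω] {P : Measure Ω}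
    [IsFiniteMeasure P] [Fintype J] {S : Set Ω} {bad : J → Set Ω} {x : ℝ} (hS : S ⊆ ⋃ j, bad j)
    (hbad : ∀ j, P.real (bad j) ≤ x) : P.real S ≤ Fintype.card J * x :=
  calc P.real S ≤ P.real (⋃ j, bad j) := measureReal_mono hS
    _ ≤ ∑ j, P.real (bad j) := measureReal_iUnion_fintype_le _
    _ ≤ ∑ _j : J, x := Finset.sum_le_sum fun j _ => hbad j
    _ = _ := by simp

/-- Tail bound for the regression errors at a single time. -/
theorem exists_policyError_tail (hF : ∀ t < T, IsUnit (closedLoop dyn pol t)) (hχ : χ₀.PosDef)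
    {t : ℕ} (ht : t < T) :
    ∃ k > 0, ∃ B > 0, ∀ (ε : ℝ), 0 < ε → ε ≤ 1 → ∀ n : ℕ, 0 < n →
      ∀ {Ω : Type u} [MeasurableSpace Ω] (P : Measure Ω) [IsProbabilityMeasure P]
        (x₀ : Fin n → Ω → EuclideanSpace ℝ (Fin nx))
        (w : Fin n → ℕ → Ω → EuclideanSpace ℝ (Fin nx))
        (ν : Fin n → ℕ → Fin N → Ω → Fin nu → ℝ),
      DemonstrationNoise P T n μ₀ χ₀ Sig σ2 x₀ w ν →
      ∀ polHat : Ω → AffinePolicy N nx nu,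
      (∀ ω, ∀ t < T, ∀ i, IsRegression (demoState dyn pol x₀ w ω t)
        (demoInput dyn pol x₀ w ν ω t i) ((polHat ω).K t i) ((polHat ω).α t i)) →
      P.real {ω | ∃ i, ε < policyError (polHat ω) pol t i} ≤ B * Real.exp (-(n * k * ε ^ 2)) := by
  obtain ⟨c, hc, hgram⟩ := exists_mean_normalizedGram_ge (noiseLaw T μ₀ χ₀ Sig)
    (z := fun y => regressor (stateFun dyn pol t y)) (measurable_regressor_stateFun t)
    (fun y => one_pos.trans_le (one_le_sum_sq_regressor _))
    (eq_zero_of_ae_sum_regressor_eq_zero hF hχ ht.le)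
  obtain ⟨b, hb, hint⟩ := exists_integrable_exp_sq_regressor (T := T) (dyn := dyn) (pol := pol)
    (μ₀ := μ₀) (χ₀ := χ₀) (Sig := Sig) t
  obtain ⟨D, hID⟩ : ∃ D : ℝ, ∀ q,
      ∫ y, Real.exp (b * regressor (stateFun dyn pol t y) q ^ 2) ∂(noiseLaw T μ₀ χ₀ Sig) ≤ D :=
    ⟨_, fun q => Finset.single_le_sum (f := fun q =>
      ∫ y, Real.exp (b * regressor (stateFun dyn pol t y) q ^ 2) ∂(noiseLaw T μ₀ χ₀ Sig))
      (fun q _ => integral_nonneg fun y => (Real.exp_pos _).le) (Finset.mem_univ q)⟩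
  -- The first condition places |t| ≤ a in the range of the bound for the moment generating
  -- function; the second is the requirement aC ≤ 1/2 of the Chernoff bound.
  obtain ⟨a, ha0, hab, haD⟩ : ∃ a > 0, σ2 * a ^ 2 / 2 ≤ b ∧
      a * (σ2 * (D - 1) / (2 * b)) ≤ 1 / 2 := by
    set G : ℝ := |σ2 * (D - 1) / (2 * b)|
    have hG0 : 0 ≤ G := abs_nonneg _
    refine ⟨min 1 (min (1 / (2 * (G + 1))) (2 * b / (σ2 + 1))),
      lt_min one_pos (lt_min (by positivity) (by positivity)), ?_⟩
    set a : ℝ := min 1 (min (1 / (2 * (G + 1))) (2 * b / (σ2 + 1)))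
    have ha0 : 0 < a := lt_min one_pos (lt_min (by positivity) (by positivity))
    have ha1 : a ≤ 1 := min_le_left _ _
    have ha2 : a ≤ 1 / (2 * (G + 1)) := (min_le_right _ _).trans (min_le_left _ _)
    have ha3 : a ≤ 2 * b / (σ2 + 1) := (min_le_right _ _).trans (min_le_right _ _)
    rw [le_div_iff₀ (by positivity)] at ha2 ha3
    constructor
    · have : (σ2 : ℝ) * a ^ 2 ≤ σ2 * a := by
        have : a ^ 2 ≤ a := by nlinarith
        gcongr
      linarith
    · have : a * (σ2 * (D - 1) / (2 * b)) ≤ a * G := by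
        gcongr; exact le_abs_self _
      linarith
  -- An entrywise error κ of the Gram matrix costs κ times its dimension, here at most half of c.
  obtain ⟨κ, hκ0, hκ1, hκc⟩ : ∃ κ : ℝ, 0 < κ ∧ κ ≤ 1 ∧
      c / 2 ≤ c - κ * (Fintype.card (Fin nx ⊕ Unit) : ℝ) := by
    have hp0 : (0 : ℝ) < (Fintype.card (Fin nx ⊕ Unit) : ℝ) := by
      exact_mod_cast Fintype.card_pos
    refine ⟨min 1 (c / (2 * (Fintype.card (Fin nx ⊕ Unit) : ℝ))),
      lt_min one_pos (by positivity), min_le_left _ _, ?_⟩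
    have h2 := mul_le_mul_of_nonneg_right
      (min_le_right 1 (c / (2 * (Fintype.card (Fin nx ⊕ Unit) : ℝ)))) hp0.le
    have h3 : c / (2 * (Fintype.card (Fin nx ⊕ Unit) : ℝ)) * (Fintype.card (Fin nx ⊕ Unit) : ℝ)
      = c / 2 := by field_simp
    linarith
  -- Correlations of size at most gε then give a policy error of at most ε.
  obtain ⟨g, hg0, hg1, hgd⟩ : ∃ g : ℝ, 0 < g ∧ g ≤ 1 ∧
      2 * g * (nu * (nx + 1)) / (c / 2) ≤ 1 := by
    set d : ℝ := nu * (nx + 1)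
    have hd0 : 0 ≤ d := by positivity
    have hg0 : 0 < min 1 (c / 2 / (2 * (d + 1))) := lt_min one_pos (by positivity)
    refine ⟨min 1 (c / 2 / (2 * (d + 1))), hg0, min_le_left _ _, ?_⟩
    have h1 := min_le_right 1 (c / 2 / (2 * (d + 1)))
    rw [le_div_iff₀ (by positivity)] at h1
    rw [div_le_one (by positivity)]
    linarith
  obtain ⟨k, hk0, hkκ, hkg⟩ : ∃ k > 0, k ≤ 1 / 2 * κ ^ 2 ∧ k ≤ a / 2 * g ^ 2 :=
    ⟨min (1 / 2 * κ ^ 2) (a / 2 * g ^ 2), lt_min (by positivity) (by positivity),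
      min_le_left _ _, min_le_right _ _⟩
  let J := ((Fin nx ⊕ Unit) × (Fin nx ⊕ Unit)) ⊕ (Fin N × Fin nu × (Fin nx ⊕ Unit))
  refine ⟨k, hk0, Fintype.card J * 2, ?_, ?_⟩
  · have : 0 < Fintype.card J := Fintype.card_pos_iff.2 ⟨Sum.inl (Sum.inr (), Sum.inr ())⟩
    positivity
  intro ε hε hε1 n hn Ω _ P _ x₀ w ν hdemo polHat hreg
  let bad : J → Set Ω := Sum.elim
    (fun pq => {ω | n * κ ≤ |∑ s, normalizedGram (regressor (demoState dyn pol x₀ w ω t s)) pq.1 pq.2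
        - n * ∫ y, normalizedGram (regressor (stateFun dyn pol t y)) pq.1 pq.2
          ∂(noiseLaw T μ₀ χ₀ Sig)|})
    (fun r => {ω | n * (g * ε) ≤
      |∑ s, ν s t r.1 ω r.2.1 * regressor (demoState dyn pol x₀ w ω t s) r.2.2|})
  have hbad : ∀ j, P.real (bad j) ≤ 2 * Real.exp (-(n * k * ε ^ 2)) := by
    rintro (⟨p, q⟩ | ⟨i, l, q⟩)
    · refine (hdemo.measureReal_gram_deviation_le ht.le p q hκ0 hκ1).trans ?_
      -- The Gram threshold κ does not depend on ε; the assumption ε ≤ 1 puts its tail under the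
      -- common rate k ε².
      have h1 : k * ε ^ 2 ≤ 1 / 2 * κ ^ 2 * 1 :=
        mul_le_mul hkκ (by nlinarith) (by positivity) (by positivity)
      have h2 := mul_le_mul_of_nonneg_left h1 (Nat.cast_nonneg (α := ℝ) n)
      refine mul_le_mul_of_nonneg_left (Real.exp_le_exp.2 ?_) zero_le_two
      linarith
    · refine (hdemo.measureReal_cross_ge_le ht i l q hb (hint q) (hID q) ha0 hab haD
        (mul_pos hg0 hε) (by nlinarith)).trans ?_
      have h1 : k * ε ^ 2 ≤ a / 2 * g ^ 2 * ε ^ 2 := mul_le_mul_of_nonneg_right hkg (by positivity)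
      have h2 := mul_le_mul_of_nonneg_left h1 (Nat.cast_nonneg (α := ℝ) n)
      refine mul_le_mul_of_nonneg_left (Real.exp_le_exp.2 ?_) zero_le_two
      linarith
  have hsub : {ω | ∃ i, ε < policyError (polHat ω) pol t i} ⊆ ⋃ j, bad j := by
    intro ω hω
    obtain ⟨i, hi⟩ := hω
    by_contra hcon
    simp only [Set.mem_iUnion, not_exists] at hcon
    have hG' : ∀ p q, |∑ s, normalizedGram (regressor (demoState dyn pol x₀ w ω t s)) p q
        - n * ∫ y, normalizedGram (regressor (stateFun dyn pol t y)) p q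
          ∂(noiseLaw T μ₀ χ₀ Sig)| ≤ n * κ :=
      fun p q => (not_le.1 (hcon (Sum.inl (p, q)))).le
    have hC' : ∀ l q, |∑ s, ν s t i ω l * regressor (demoState dyn pol x₀ w ω t s) q|
        ≤ n * (g * ε) := fun l q => (not_le.1 (hcon (Sum.inr (i, l, q)))).le
    have hlow := sum_sq_ge_of_normalizedGram_close (fun s => one_le_sum_sq_regressor _) hgram hG'
    have herr := (hreg ω t ht i).policyError_le (ν := fun s => ν s t i ω) hn
      (c := c / 2) (by positivity)
      (fun v => by
        refine le_trans ?_ (hlow v)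
        have : 0 ≤ ∑ q, v q ^ 2 := Finset.sum_nonneg fun _ _ => sq_nonneg _
        gcongr) hC'
    have : 2 * (g * ε) * (nu * (nx + 1)) / (c / 2) ≤ ε := by
      calc 2 * (g * ε) * (nu * (nx + 1)) / (c / 2) = (2 * g * (nu * (nx + 1)) / (c / 2)) * ε := by ring
        _ ≤ 1 * ε := by gcongr
        _ = ε := one_mul ε
    exact absurd hi (not_lt.2 (herr.trans this))
  rw [mul_assoc]
  exact measureReal_le_card_mul_of_subset_iUnion hsub hbad

/-- Tail bound for the regression errors at all times before `r`. -/
theorem exists_policyError_tail_uniform (hF : ∀ t < T, IsUnit (closedLoop dyn pol t))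
    (hχ : χ₀.PosDef) (r : ℕ) (hr : r ≤ T) :
    ∃ k > 0, ∃ B > 0, ∀ (ε : ℝ), 0 < ε → ε ≤ 1 → ∀ n : ℕ, 0 < n →
      ∀ {Ω : Type u} [MeasurableSpace Ω] (P : Measure Ω) [IsProbabilityMeasure P]
        (x₀ : Fin n → Ω → EuclideanSpace ℝ (Fin nx))
        (w : Fin n → ℕ → Ω → EuclideanSpace ℝ (Fin nx))
        (ν : Fin n → ℕ → Fin N → Ω → Fin nu → ℝ),
      DemonstrationNoise P T n μ₀ χ₀ Sig σ2 x₀ w ν →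
      ∀ polHat : Ω → AffinePolicy N nx nu,
      (∀ ω, ∀ t < T, ∀ i, IsRegression (demoState dyn pol x₀ w ω t)
        (demoInput dyn pol x₀ w ν ω t i) ((polHat ω).K t i) ((polHat ω).α t i)) →
      P.real {ω | ∃ t < r, ∃ i, ε < policyError (polHat ω) pol t i}
        ≤ B * Real.exp (-(n * k * ε ^ 2)) := by
  induction r with
  | zero =>
    refine ⟨1, one_pos, 1, one_pos, ?_⟩
    intro ε hε hε1 n hn Ω _ P _ x₀ w ν hdemo polHat hreg
    simp only [not_lt_zero, false_and, exists_false, Set.ofPred_false, measureReal_empty]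
    positivity
  | succ r ih =>
    obtain ⟨k₁, hk₁, B₁, hB₁, h₁⟩ := ih (by omega)
    obtain ⟨k₂, hk₂, B₂, hB₂, h₂⟩ := exists_policyError_tail.{u} (μ₀ := μ₀) (Sig := Sig)
      (σ2 := σ2) hF hχ (t := r) (by omega)
    refine ⟨min k₁ k₂, lt_min hk₁ hk₂, B₁ + B₂, by positivity, ?_⟩
    intro ε hε hε1 n hn Ω _ P _ x₀ w ν hdemo polHat hreg
    have e₁ := h₁ ε hε hε1 n hn P x₀ w ν hdemo polHat hreg
    have e₂ := h₂ ε hε hε1 n hn P x₀ w ν hdemo polHat hreg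
    have hsub : {ω | ∃ t < r + 1, ∃ i, ε < policyError (polHat ω) pol t i}
        ⊆ {ω | ∃ t < r, ∃ i, ε < policyError (polHat ω) pol t i} ∪
          {ω | ∃ i, ε < policyError (polHat ω) pol r i} := by
      rintro ω ⟨t, ht, i, hi⟩
      rcases Nat.lt_succ_iff_lt_or_eq.1 ht with h | rfl
      · exact Or.inl ⟨t, h, i, hi⟩
      · exact Or.inr ⟨i, hi⟩
    have m₁ : Real.exp (-(n * k₁ * ε ^ 2)) ≤ Real.exp (-(n * min k₁ k₂ * ε ^ 2)) := by
      gcongr; exact min_le_left _ _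
    have m₂ : Real.exp (-(n * k₂ * ε ^ 2)) ≤ Real.exp (-(n * min k₁ k₂ * ε ^ 2)) := by
      gcongr; exact min_le_right _ _
    calc _ ≤ _ := measureReal_mono hsub
      _ ≤ _ := measureReal_union_le _ _
      _ ≤ B₁ * Real.exp (-(n * min k₁ k₂ * ε ^ 2)) + B₂ * Real.exp (-(n * min k₁ k₂ * ε ^ 2)) := by
          refine add_le_add (e₁.trans ?_) (e₂.trans ?_) <;> gcongr
      _ = _ := by ring

/-- With the sample size `sampleSize`, an exponential tail drops below `δ`. -/
theorem exists_sampleSize_tail_le {k : ℝ} (hk : 0 < k) (B : ℝ) (nx : ℕ) :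
    ∃ c > 0, ∀ ε δ : ℝ, 0 < ε → 0 < δ → δ < 1 → ∀ n : ℕ, sampleSize c c (nx + 1) ε δ ≤ n →
      0 < n ∧ B * Real.exp (-(n * k * min ε 1 ^ 2)) ≤ δ := by
  -- The prefactor B is absorbed by a power: the sample size makes the exponential at most
  -- (δ/2)^(m+1), and 2^(m+1) ≥ B leaves δ^(m+1) ≤ δ.
  obtain ⟨m, hm⟩ := pow_unbounded_of_one_lt B (one_lt_two (α := ℝ))
  have hm' : B ≤ 2 ^ (m + 1) := hm.le.trans (pow_le_pow_right₀ one_le_two (by omega))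
  refine ⟨(m + 1) / k, by positivity, fun ε δ hε hδ hδ1 n hn => ?_⟩
  set L := Real.log (2 * ((nx + 1 : ℕ) : ℝ) / δ) with hL
  have hq : 2 / δ ≤ 2 * ((nx + 1 : ℕ) : ℝ) / δ := by
    gcongr
    push_cast
    linarith [Nat.cast_nonneg (α := ℝ) nx]
  have h2δ : 1 < 2 / δ := by rw [lt_div_iff₀ hδ]; linarith
  have hL2 : Real.log (2 / δ) ≤ L := Real.log_le_log (by positivity) hq
  have hL0 : 0 < L := (Real.log_pos h2δ).trans_le hL2
  have hn1 : (m + 1) / k / ε ^ 2 * L ≤ n := (le_max_left _ _).trans hn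
  have hn2 : (m + 1) / k * L ≤ n := (le_max_right _ _).trans hn
  have hnpos : (0 : ℝ) < n := lt_of_lt_of_le (by positivity) hn2
  refine ⟨by exact_mod_cast hnpos, ?_⟩
  -- The first term of the maximum in the sample size serves ε ≤ 1, the second one ε ≥ 1, where the
  -- tail bound is used at 1.
  have hkey : (m + 1) * L ≤ n * k * min ε 1 ^ 2 := by
    rcases le_total ε 1 with h | h
    · rw [min_eq_left h]
      rw [div_div, div_mul_eq_mul_div, div_le_iff₀ (by positivity)] at hn1
      linarith
    · rw [min_eq_right h]
      rw [div_mul_eq_mul_div, div_le_iff₀ hk] at hn2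
      linarith
  have hexp : Real.exp (-(n * k * min ε 1 ^ 2)) ≤ (δ / 2) ^ (m + 1) := by
    calc Real.exp (-(n * k * min ε 1 ^ 2)) ≤ Real.exp (-((m + 1) * Real.log (2 / δ))) := by
          refine Real.exp_le_exp.2 (neg_le_neg (le_trans ?_ hkey))
          gcongr
      _ = (δ / 2) ^ (m + 1) := by
          rw [← Real.log_rpow (by positivity), ← Real.log_inv, Real.exp_log (by positivity),
            show ((m : ℝ) + 1) = ((m + 1 : ℕ) : ℝ) by push_cast; ring, Real.rpow_natCast,
            ← inv_pow, inv_div]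
  calc B * Real.exp (-(n * k * min ε 1 ^ 2)) ≤ 2 ^ (m + 1) * (δ / 2) ^ (m + 1) := by gcongr
    _ = δ ^ (m + 1) := by rw [← mul_pow]; congr 1; ring
    _ ≤ δ := pow_le_of_le_one hδ.le hδ1.le (by omega)

/-- The estimates are arbitrary functions of ω, so the bad set need not be measurable. Its
measurable hull has the same measure, and the complement of the hull is the required event. -/
theorem holdsWithProb_of_measureReal_le {Ω : Type*} [MeasurableSpace Ω] {P : Measure Ω}
    [IsProbabilityMeasure P] {bad : Set Ω} {δ p : ℝ} (hbad : P.real bad ≤ δ) (hp : p ≤ 1 - δ)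
    {good : Ω → Prop} (h : ∀ ω ∉ bad, good ω) : HoldsWithProb P p good := by
  refine ⟨(toMeasurable P bad)ᶜ, (measurableSet_toMeasurable P bad).compl, ?_,
    fun ω hω => h ω fun hb => hω (subset_toMeasurable P bad hb)⟩
  rw [probReal_compl_eq_one_sub (measurableSet_toMeasurable P bad), measureReal_def,
    measure_toMeasurable, ← measureReal_def]
  linarith

end Estimation

/-! ### The theorem. -/

theorem theorem1 {N nx nu : ℕ} (T : ℕ) (dyn : LinearDynamics N nx nu)
    (pol : AffinePolicy N nx nu)
    (hF : ∀ t < T, IsUnit (closedLoop dyn pol t))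
    (μ₀ : EuclideanSpace ℝ (Fin nx)) (χ₀ : Matrix (Fin nx) (Fin nx) ℝ) (hχ : χ₀.PosDef)
    (Sig : ℕ → Matrix (Fin nx) (Fin nx) ℝ) (hSig : ∀ t < T, (Sig t).PosSemidef)
    (σ2 : ℝ≥0) (τ : ℝ) (hτ : 0 < τ)
    (θ : ℕ → Fin N → ParamIdx nx nu → ℝ) (hθ : IsIdentified T τ dyn pol θ) :
    ∃ c₁ > 0, ∃ c₂ > 0, ∃ C > 0, ∃ ε₀ > 0,
      ∀ (ε δ : ℝ), 0 < ε → 0 < δ → δ < 1 →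
      ∀ n : ℕ, sampleSize c₁ c₂ (nx + 1) ε δ ≤ n →
      ∀ {Ω : Type*} [MeasurableSpace Ω] (P : Measure Ω) [IsProbabilityMeasure P]
        (x₀ : Fin n → Ω → EuclideanSpace ℝ (Fin nx))
        (w : Fin n → ℕ → Ω → EuclideanSpace ℝ (Fin nx))
        (ν : Fin n → ℕ → Fin N → Ω → Fin nu → ℝ),
      DemonstrationNoise P T n μ₀ χ₀ Sig σ2 x₀ w ν →
      ∀ polHat : Ω → AffinePolicy N nx nu,
      (∀ ω, ∀ t < T, ∀ i, IsRegression (demoState dyn pol x₀ w ω t)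
        (demoInput dyn pol x₀ w ν ω t i) ((polHat ω).K t i) ((polHat ω).α t i)) →
      (∀ t < T, ∀ i, HoldsWithProb P (1 - δ) fun ω => policyError (polHat ω) pol t i ≤ ε) ∧
      (ε ≤ ε₀ →
        ∀ θHat : Ω → ℕ → Fin N → ParamIdx nx nu → ℝ,
        (∀ ω, IsIdentified T τ dyn (polHat ω) (θHat ω)) →
        ∀ t, 1 ≤ t → t ≤ T → ∀ i,
          HoldsWithProb P ((1 - δ) ^ (T - t + 1)) fun ω =>
            (∀ r, 1 ≤ r → r ≤ T → ∀ j,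
              activeSet τ (θHat ω r j) = activeSet τ (θ r j) ∧
              freeRank τ (matM T dyn (polHat ω) (θHat ω) r j) (θHat ω r j)
                = freeRank τ (matM T dyn pol θ r j) (θ r j)) →
            ‖WithLp.toLp 2 (θHat ω t i - θ t i)‖ ≤ C * ε) := by
  obtain ⟨k, hk, B, -, htail⟩ := exists_policyError_tail_uniform (μ₀ := μ₀) (Sig := Sig)
    (σ2 := σ2) hF hχ T le_rfl
  obtain ⟨c, hc, hsize⟩ := exists_sampleSize_tail_le hk B nx
  obtain ⟨C, hC, ε₀, hε₀, hlip⟩ := exists_identified_lipschitz hF hθ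
  refine ⟨c, hc, c, hc, C, hC, ε₀, hε₀, ?_⟩
  intro ε δ hε hδ hδ1 n hn Ω _ P _ x₀ w ν hdemo polHat hreg
  obtain ⟨hn0, hB'⟩ := hsize ε δ hε hδ hδ1 n hn
  have hbad := (htail (min ε 1) (lt_min hε one_pos) (min_le_right _ _) n hn0 P x₀ w ν hdemo polHat
    hreg).trans hB'
  have hgood : ∀ ω ∉ {ω | ∃ t < T, ∃ i, min ε 1 < policyError (polHat ω) pol t i},
      ∀ t < T, ∀ i, policyError (polHat ω) pol t i ≤ ε := by
    intro ω hω t ht i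
    by_contra hcon
    exact hω ⟨t, ht, i, (min_le_left _ _).trans_lt (not_le.1 hcon)⟩
  refine ⟨fun t ht i => holdsWithProb_of_measureReal_le hbad le_rfl
    fun ω hω => hgood ω hω t ht i, ?_⟩
  intro hεε₀ θHat hθHat t ht1 htT i
  -- The same bad set serves all t and i, so no loss accumulates over the stages; the power is at
  -- most 1 - δ because its exponent is at least 1.
  refine holdsWithProb_of_measureReal_le hbad
    (pow_le_of_le_one (by linarith) (by linarith) (by omega)) fun ω hω hcond => ?_
  exact hlip ε (polHat ω) (θHat ω) hε hεε₀ (hgood ω hω) (hθHat ω) hcond t ht1 htT i
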